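/- Let $S, X, T$ be discrete random variables with joint law $P_{S,X,T}$ on alphabets $\mathcal S$ (finite), $\mathcal X$ and $\mathcal T$ (each finite or countably infinite). All entropies, mutual informations and logarithms are to base $2$; entropies may be $+\infty$. For $r,\varepsilon\ge 0$ let $$g^r_\varepsilon(P_{S,X,T})=\sup\{I(Y;T)\;:\;P_{Y|S,X,T},\ I(Y;S)\le\varepsilon,\ I(X;Y)\le r\},$$ the supremum being over all discrete random variables $Y$ (countable alphabet) given by a conditional law $P_{Y|S,X,T}$. Put $$\alpha=\frac{r}{H(X|S)+\varepsilon},\qquad \tilde\alpha=\frac{\varepsilon}{H(S|X)+r}\qquad\Bigl(\tfrac00:=0\Bigr),$$ $$\begin{aligned} L_0&=H(T|X,S)-\bigl(\log(I(X,S;T)+5.51)+1.06\bigr),\\ L_1^{r,\varepsilon}&=H(T|X,S)+r-H(X,S|T),\\ L_2^{r,\varepsilon}&=H(T|X,S)+r-\alpha H(X,S|T)-1.06-\log\bigl((1-\alpha)I(X,S;T)+\alpha\min\{H(T),H(X,S)\}+5.51\bigr),\\ L_1'^{\,r,\varepsilon}&=H(T|S)-H(S|T)+\varepsilon,\\ L_3^{r,\varepsilon}&=H(T|X,S)+\varepsilon-H(X,S|T),\\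 L_4^{r,\varepsilon}&=H(T|X,S)+\varepsilon-\tilde\alpha H(X,S|T)-1.06-\log\bigl((1-\tilde\alpha)I(X,S;T)+\tilde\alpha\min\{H(T),H(X,S)\}+5.51\bigr),\\ L_3'^{\,r,\varepsilon}&=H(T|X)-H(X|T)+r, \end{aligned}$$ with values in $[-\infty,\infty]$, where $x-\infty=-\infty$ for every $x$ (also $x=\infty$) and $0\cdot\infty=0$. Then, for all $r,\varepsilon\ge0$, $$g^r_\varepsilon(P_{S,X,T})\le\min\{H(T|S)+\varepsilon,\;H(T|X)+r\}\qquad\text{and}\qquad L_0\le g^r_\varepsilon(P_{S,X,T}).$$ Moreover: 1. If $0\le r\le H(X|S)+\varepsilon$ and $\varepsilon\le H(S)$, then $\max\{L_0,L_1^{r,\varepsilon}\}\le g^r_\varepsilon(P_{S,X,T})$, and if in addition $H(X)<\infty$, then $\max\{L_0,L_1^{r,\varepsilon},L_2^{r,\varepsilon}\}\le g^r_\varepsilon(P_{S,X,T})$. 2. If $H(X|S)+\varepsilon\le r<H(X)$, then $\max\{L_0,L_1'^{\,r,\varepsilon}\}\le g^r_\varepsilon(P_{S,X,T})$. 3. If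 $r\le\varepsilon\le H(S|X)+r$ and $r\le H(X)$, then $\max\{L_0,L_3^{r,\varepsilon},L_4^{r,\varepsilon}\}\le g^r_\varepsilon(P_{S,X,T})$. 4. If $H(S|X)+r\le\varepsilon<H(S)$, then $\max\{L_0,L_3'^{\,r,\varepsilon}\}\le g^r_\varepsilon(P_{S,X,T})$. -/

import Mathlib

open scoped ENNReal NNReal

noncomputable section

namespace FairRep

universe u v w z

/-! ## Information measures of discrete random variables

A discrete random variable is a function on a type `Ω` that carries a probability mass function
`p : PMF Ω`. All information measures are in bits and take values in `[0, ∞]`, because entropies on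
countably infinite alphabets can be infinite. -/

section InfoMeasures

variable {Ω : Type u} {α : Type v} {β : Type w}

/-- Shannon entropy `H(A) = ∑ₐ P(A = a) log₂ (1 / P(A = a))`. -/
def entropy (p : PMF Ω) (A : Ω → α) : ℝ≥0∞ :=
  ∑' a : α, ENNReal.ofReal
    ((p.map A a).toReal * Real.logb 2 (1 / (p.map A a).toReal))

/-- Conditional entropy
`H(A|B) = ∑ P(A = a, B = b) log₂ (P(B = b) / P(A = a, B = b))`, the sum over all pairs `(a, b)`.
No summand is negative. -/
def condEntropy (p : PMF Ω) (A : Ω → α) (B : Ω → β) : ℝ≥0∞ :=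
  ∑' c : α × β, ENNReal.ofReal
    ((p.map (fun ω => (A ω, B ω)) c).toReal *
      Real.logb 2 ((p.map B c.2).toReal / (p.map (fun ω => (A ω, B ω)) c).toReal))

/-- Kullback-Leibler divergence of two probability mass functions, in bits. -/
def klBits (p q : PMF α) : ℝ≥0∞ :=
  letI : MeasurableSpace α := ⊤
  InformationTheory.klDiv p.toMeasure q.toMeasure / ENNReal.ofReal (Real.log 2)

/-- The product of two probability mass functions: the law of an independent pair. -/
def prodPMF (p : PMF α) (q : PMF β) : PMF (α × β) :=
  p.bind fun a => q.map fun b => (a, b)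

/-- Mutual information `I(A;B) = D(P_{A,B} ‖ P_A × P_B)`. -/
def mutualInfo (p : PMF Ω) (A : Ω → α) (B : Ω → β) : ℝ≥0∞ :=
  klBits (p.map fun ω => (A ω, B ω)) (prodPMF (p.map A) (p.map B))

/-- Base-two logarithm `[0, ∞] → [-∞, ∞]`. -/
def log2 (x : ℝ≥0∞) : EReal := ENNReal.log x / ((Real.log 2 : ℝ) : EReal)

end InfoMeasures

/-! ## The trade-off -/

section TradeOff

variable {𝒮 : Type u} {𝒳 : Type v} {𝒯 : Type w}

/-- The joint law `P_{(S,X,T),Y}` obtained from `P_{S,X,T}` and a randomized map `P_{Y|S,X,T}`. -/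
def jointLaw {𝒴 : Type z} (P : PMF (𝒮 × 𝒳 × 𝒯)) (W : 𝒮 × 𝒳 × 𝒯 → PMF 𝒴) :
    PMF ((𝒮 × 𝒳 × 𝒯) × 𝒴) :=
  P.bind fun a => (W a).map fun y => (a, y)

/-- The trade-off
`g^r_ε(P_{S,X,T}) = sup { I(Y;T) : P_{Y|S,X,T} with I(Y;S) ≤ ε and I(X;Y) ≤ r }`,
over all discrete (that is, countably valued) representations `Y`. -/
def tradeOff (P : PMF (𝒮 × 𝒳 × 𝒯)) (r ε : ℝ≥0) : ℝ≥0∞ :=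
  sSup {i : ℝ≥0∞ | ∃ (𝒴 : Type) (_ : Countable 𝒴) (W : 𝒮 × 𝒳 × 𝒯 → PMF 𝒴),
    mutualInfo (jointLaw P W) (fun ω => ω.2) (fun ω => ω.1.1) ≤ ε ∧
    mutualInfo (jointLaw P W) (fun ω => ω.1.2.1) (fun ω => ω.2) ≤ r ∧
    i = mutualInfo (jointLaw P W) (fun ω => ω.2) (fun ω => ω.1.2.2)}

end TradeOff

/-! ## Information quantities of `(S, X, T) ∼ P` and the lower bounds -/

section Bounds

variable {𝒮 : Type u} {𝒳 : Type v} {𝒯 : Type w} (P : PMF (𝒮 × 𝒳 × 𝒯))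

/-- The sensitive attribute `S`. -/
def S (ω : 𝒮 × 𝒳 × 𝒯) : 𝒮 := ω.1

/-- The useful data `X`. -/
def X (ω : 𝒮 × 𝒳 × 𝒯) : 𝒳 := ω.2.1

/-- The task `T`. -/
def T (ω : 𝒮 × 𝒳 × 𝒯) : 𝒯 := ω.2.2

/-- The pair `(X, S)`. -/
def XS (ω : 𝒮 × 𝒳 × 𝒯) : 𝒳 × 𝒮 := (X ω, S ω)

/-- The weight `α = r / (H(X|S) + ε)`. -/
def weight (r ε : ℝ≥0) : ℝ≥0∞ := r / (condEntropy P X S + ε)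

/-- The weight `α̃ = ε / (H(S|X) + r)`. -/
def weight' (r ε : ℝ≥0) : ℝ≥0∞ := ε / (condEntropy P S X + r)

/-- `log₂ ((1 - a) I(X,S;T) + a min {H(T), H(X,S)} + 5.51)`, for `a ∈ [0, 1]`. -/
def logTerm (a : ℝ≥0∞) : EReal :=
  log2 ((1 - a) * mutualInfo P XS T + a * min (entropy P T) (entropy P XS) +
    ENNReal.ofReal 5.51)

/-- `L₀ = H(T|X,S) - (log₂ (I(X,S;T) + 5.51) + 1.06)`. The lower bounds are extended real numbers;
in `EReal` a difference `x - ∞` is `-∞` for every `x`, also for `x = ∞`. -/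
def L0 : EReal :=
  condEntropy P T XS -
    (log2 (mutualInfo P XS T + ENNReal.ofReal 5.51) + ((1.06 : ℝ) : EReal))

/-- `L₁ = H(T|X,S) + r - H(X,S|T)`. -/
def L1 (r : ℝ≥0) : EReal :=
  condEntropy P T XS + ((r : ℝ) : EReal) - condEntropy P XS T

/-- `L₂ = H(T|X,S) + r - α H(X,S|T) - 1.06
  - log₂ ((1 - α) I(X,S;T) + α min {H(T), H(X,S)} + 5.51)`. -/
def L2 (r ε : ℝ≥0) : EReal :=
  condEntropy P T XS + ((r : ℝ) : EReal)
    - ((weight P r ε * condEntropy P XS T : ℝ≥0∞) : EReal)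
    - ((1.06 : ℝ) : EReal) - logTerm P (weight P r ε)

/-- `L₁' = H(T|S) - H(S|T) + ε`. -/
def L1' (ε : ℝ≥0) : EReal :=
  condEntropy P T S - condEntropy P S T + ((ε : ℝ) : EReal)

/-- `L₃ = H(T|X,S) + ε - H(X,S|T)`. -/
def L3 (ε : ℝ≥0) : EReal :=
  condEntropy P T XS + ((ε : ℝ) : EReal) - condEntropy P XS T

/-- `L₄ = H(T|X,S) + ε - α̃ H(X,S|T) - 1.06
  - log₂ ((1 - α̃) I(X,S;T) + α̃ min {H(T), H(X,S)} + 5.51)`. -/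
def L4 (r ε : ℝ≥0) : EReal :=
  condEntropy P T XS + ((ε : ℝ) : EReal)
    - ((weight' P r ε * condEntropy P XS T : ℝ≥0∞) : EReal)
    - ((1.06 : ℝ) : EReal) - logTerm P (weight' P r ε)

/-- `L₃' = H(T|X) - H(X|T) + r`. -/
def L3' (r : ℝ≥0) : EReal :=
  condEntropy P T X - condEntropy P X T + ((r : ℝ) : EReal)

end Bounds

end FairRep

end

/-! The upper bound is I(Y;T) ≤ I(Y;A) + H(T|A) for A = S and for A = X
(`mutualInfo_le_add_condEntropy`). For the lower bounds X and S play symmetric roles, so `frontier`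
takes two arbitrary constrained variables A, B and budgets ρ, σ. It is concave in (ρ, σ): showing
the outcome of an independent coin together with one of two representations mixes all informations
linearly (`repInfo_timeShare`, `frontier_concave`). It therefore suffices to find good points and to
interpolate.

The points come from `exists_functional_rep`. Let Y be a random function y, independent of A, with
y(a) distributed as T given A = a, coupled so that T = y(A). Then I(Y;A,T) is H(T|A), and passing to
I(Y;T) costs at most H(A|T). It also costs at most log(I(A;T) + 5.51) + 1.06 if all y(a) are driven
by the same exponential clocks: y(a) is the first clock to ring when clock k has speed q(k|a). The
reading of the winning clock has mean q(k|a), so a decoder weight that decays slightly faster than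
1/x in the reading x earns about log 1/q(k|a) in Gibbs' inequality, which averages to H(T|A).

Taking (A,B) for A gives a point at budgets (0, 0), hence L₀. If the constraint on B is dropped, the
functional representation for A (budget 0) and the one for a constant (budget H(A)) interpolate to a
line of slope one (`condEntropy_add_le_frontier_top`). The dropped constraint holds anyway once σ ≥
H(B|A) + ρ, which gives L₁' and L₃'. Interpolating the point with σ = H(B|A) + ρ with (0, 0) gives
L₁, L₃ or L₂, L₄, according to which of the two losses is used at (0, 0). When an entropy that would
fix the mixing weight is infinite, a representation with huge finite information is shown with
vanishing probability instead (`add_le_of_vanishing_timeShare`). -/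

noncomputable section

namespace FairRep

open MeasureTheory

universe u v w z

/-! ### Marginals and products of discrete laws. -/

section Marginals

variable {Ω : Type u} {α : Type v} {β : Type w} {γ : Type z}

/-- The probability `P(A = a)` as a real number. -/
def prob (p : PMF Ω) (A : Ω → α) (a : α) : ℝ := (p.map A a).toReal

lemma prob_nonneg (p : PMF Ω) (A : Ω → α) (a : α) : 0 ≤ prob p A a := ENNReal.toReal_nonneg

lemma ofReal_prob (p : PMF Ω) (A : Ω → α) (a : α) : ENNReal.ofReal (prob p A a) = p.map A a :=
  ENNReal.ofReal_toReal (PMF.apply_ne_top _ _)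

lemma hasSum_prob (p : PMF Ω) (A : Ω → α) : HasSum (prob p A) 1 := by
  have h := ENNReal.hasSum_toReal (f := p.map A) (PMF.tsum_coe_ne_top _)
  rwa [← ENNReal.tsum_toReal_eq (fun _ => PMF.apply_ne_top _ _), PMF.tsum_coe,
    ENNReal.toReal_one] at h

open scoped Classical in
lemma map_apply_comp (p : PMF Ω) (A : Ω → α) (f : α → β) (b : β) :
    p.map (fun ω => f (A ω)) b = ∑' a, if b = f a then p.map A a else 0 := by
  rw [show (fun ω => f (A ω)) = f ∘ A from rfl, ← PMF.map_comp, PMF.map_apply]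

lemma tsum_map_snd (p : PMF Ω) (A : Ω → α) (B : Ω → β) (a : α) :
    ∑' b, p.map (fun ω => (A ω, B ω)) (a, b) = p.map A a := by
  have h := map_apply_comp p (fun ω => (A ω, B ω)) Prod.fst a
  simp only at h
  change p.map A a = _ at h
  rw [h, ENNReal.tsum_prod', tsum_eq_single a]
  · simp [-PMF.map_apply]
  · intro a' h'
    simp [-PMF.map_apply, Ne.symm h']

lemma tsum_map_fst (p : PMF Ω) (A : Ω → α) (B : Ω → β) (b : β) :
    ∑' a, p.map (fun ω => (A ω, B ω)) (a, b) = p.map B b := by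
  have h := map_apply_comp p (fun ω => (A ω, B ω)) Prod.snd b
  simp only at h
  change p.map B b = _ at h
  rw [h, ENNReal.tsum_prod', ENNReal.tsum_comm, tsum_eq_single b]
  · simp [-PMF.map_apply]
  · intro a' h'
    simp [-PMF.map_apply, Ne.symm h']

lemma hasSum_prob_snd (p : PMF Ω) (A : Ω → α) (B : Ω → β) (a : α) :
    HasSum (fun b => prob p (fun ω => (A ω, B ω)) (a, b)) (prob p A a) := by
  have h := ENNReal.hasSum_toReal (f := fun b => p.map (fun ω => (A ω, B ω)) (a, b))
    (by rw [tsum_map_snd]; exact PMF.apply_ne_top _ _)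
  rwa [← ENNReal.tsum_toReal_eq (fun _ => PMF.apply_ne_top _ _), tsum_map_snd] at h

lemma hasSum_prob_fst (p : PMF Ω) (A : Ω → α) (B : Ω → β) (b : β) :
    HasSum (fun a => prob p (fun ω => (A ω, B ω)) (a, b)) (prob p B b) := by
  have h := ENNReal.hasSum_toReal (f := fun a => p.map (fun ω => (A ω, B ω)) (a, b))
    (by rw [tsum_map_fst]; exact PMF.apply_ne_top _ _)
  rwa [← ENNReal.tsum_toReal_eq (fun _ => PMF.apply_ne_top _ _), tsum_map_fst] at h

lemma prob_pair_le_left (p : PMF Ω) (A : Ω → α) (B : Ω → β) (a : α) (b : β) :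
    prob p (fun ω => (A ω, B ω)) (a, b) ≤ prob p A a :=
  le_hasSum (hasSum_prob_snd p A B a) b fun _ _ => prob_nonneg _ _ _

lemma prob_pair_le_right (p : PMF Ω) (A : Ω → α) (B : Ω → β) (a : α) (b : β) :
    prob p (fun ω => (A ω, B ω)) (a, b) ≤ prob p B b :=
  le_hasSum (hasSum_prob_fst p A B b) a fun _ _ => prob_nonneg _ _ _

/-- Relabelling a random variable injectively does not change its probabilities. -/
lemma prob_comp_injective (p : PMF Ω) (A : Ω → α) {f : α → β} (hf : f.Injective) (a : α) :
    prob p (fun ω => f (A ω)) (f a) = prob p A a := by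
  rw [prob, prob, map_apply_comp, tsum_eq_single a]
  · simp [-PMF.map_apply]
  · intro a' h'
    simp [-PMF.map_apply, hf.eq_iff, Ne.symm h']

lemma prodPMF_apply (p : PMF α) (q : PMF β) (a : α) (b : β) : prodPMF p q (a, b) = p a * q b := by
  rw [prodPMF, PMF.bind_apply, tsum_eq_single a]
  · rw [PMF.map_apply, tsum_eq_single b]
    · simp
    · intro b' h'; simp [Ne.symm h']
  · intro a' h'
    simp only [PMF.map_apply, Prod.mk.injEq, Ne.symm h', false_and, if_false, tsum_zero, mul_zero]

lemma prodPMF_map (p : PMF α) (q : PMF β) {α' : Type*} {β' : Type*} (f : α → α') (g : β → β') :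
    prodPMF (p.map f) (q.map g) = (prodPMF p q).map (Prod.map f g) := by
  simp only [prodPMF, PMF.bind_map, PMF.map_bind, PMF.map_comp]
  rfl

lemma prodPMF_swap (p : PMF α) (q : PMF β) : (prodPMF p q).map Prod.swap = prodPMF q p := by
  simp only [prodPMF, PMF.map_bind, PMF.map_comp]
  simp only [← PMF.bind_pure_comp]
  rw [PMF.bind_comm]
  rfl

end Marginals

/-! ### Divergence and mutual information as sums of nonnegative terms. -/

section Divergence

variable {Ω : Type u} {α : Type v} {β : Type w} {γ : Type z}

lemma klBits_map_le (p q : PMF α) (f : α → β) : klBits (p.map f) (q.map f) ≤ klBits p q := by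
  let _ : MeasurableSpace α := ⊤
  let _ : MeasurableSpace β := ⊤
  unfold klBits
  refine ENNReal.div_le_div_right ?_ _
  rw [← PMF.toMeasure_map (hf := measurable_from_top), ← PMF.toMeasure_map (hf := measurable_from_top)]
  exact InformationTheory.klDiv_map_le _ _ measurable_from_top

lemma mutualInfo_symm (p : PMF Ω) (A : Ω → α) (B : Ω → β) :
    mutualInfo p A B = mutualInfo p B A := by
  have key : ∀ {α : Type v} {β : Type w} (A : Ω → α) (B : Ω → β),
      mutualInfo p B A ≤ mutualInfo p A B := by
    intro α β A B
    unfold mutualInfo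
    rw [← prodPMF_swap, show (fun ω => (B ω, A ω)) = Prod.swap ∘ fun ω => (A ω, B ω) from rfl,
      ← PMF.map_comp]
    exact klBits_map_le _ _ _
  have key' : ∀ {α : Type w} {β : Type v} (A : Ω → α) (B : Ω → β),
      mutualInfo p B A ≤ mutualInfo p A B := by
    intro α β A B
    unfold mutualInfo
    rw [← prodPMF_swap, show (fun ω => (B ω, A ω)) = Prod.swap ∘ fun ω => (A ω, B ω) from rfl,
      ← PMF.map_comp]
    exact klBits_map_le _ _ _
  exact le_antisymm (key' _ _) (key _ _)

/-- Data processing. -/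
lemma mutualInfo_comp_right_le (p : PMF Ω) (A : Ω → α) (B : Ω → β) (f : β → γ) :
    mutualInfo p A (fun ω => f (B ω)) ≤ mutualInfo p A B := by
  unfold mutualInfo
  have h1 : (p.map fun ω => (A ω, f (B ω))) = (p.map fun ω => (A ω, B ω)).map (Prod.map id f) := by
    rw [PMF.map_comp]; rfl
  have h2 : p.map (fun ω => f (B ω)) = (p.map B).map f := by rw [PMF.map_comp]; rfl
  have h3 : p.map A = (p.map A).map id := (PMF.map_id _).symm
  rw [h1, h2]
  conv_lhs => rw [h3]
  rw [prodPMF_map]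
  exact klBits_map_le _ _ _

lemma mutualInfo_eq_zero (p : PMF Ω) (A : Ω → α) (B : Ω → β)
    (h : (p.map fun ω => (A ω, B ω)) = prodPMF (p.map A) (p.map B)) : mutualInfo p A B = 0 := by
  let _ : MeasurableSpace (α × β) := ⊤
  unfold mutualInfo klBits
  rw [h, InformationTheory.klDiv_self]
  simp

/-- The summand `x log (x / y) + y - x` of the divergence of two discrete laws. -/
def klTerm (x y : ℝ) : ℝ := x * Real.log (x / y) + y - x

lemma klTerm_eq {x y : ℝ} (h : y = 0 → x = 0) :
    klTerm x y = y * InformationTheory.klFun (x / y) := by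
  by_cases hy : y = 0
  · simp [klTerm, hy, h hy]
  · rw [klTerm, InformationTheory.klFun_apply]
    field_simp

lemma klTerm_nonneg {x y : ℝ} (hx : 0 ≤ x) (hy : 0 ≤ y) (h : y = 0 → x = 0) : 0 ≤ klTerm x y := by
  rw [klTerm_eq h]
  exact mul_nonneg hy (InformationTheory.klFun_nonneg (div_nonneg hx hy))

/-- Gibbs' inequality for a single summand. -/
lemma le_klTerm {x y g : ℝ} (hx : 0 ≤ x) (hy : 0 ≤ y) (h : y = 0 → x = 0) (hg : 0 < g) :
    x * Real.log g - y * g + y ≤ klTerm x y := by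
  rcases hx.eq_or_lt with rfl | hx
  · simp only [klTerm, zero_mul, zero_sub, zero_add, sub_zero]
    nlinarith
  have hy : 0 < y := hy.lt_of_ne fun h' => hx.ne' (h h'.symm)
  have h1 := Real.log_le_sub_one_of_pos (show 0 < y * g / x by positivity)
  have h2 : Real.log (y * g / x) = Real.log g - Real.log (x / y) := by
    rw [Real.log_div (by positivity) hx.ne', Real.log_mul hy.ne' hg.ne',
      Real.log_div hx.ne' hy.ne']
    ring
  rw [h2] at h1
  have h3 := mul_le_mul_of_nonneg_left h1 hx.le
  have h4 : x * (y * g / x - 1) = y * g - x := by field_simp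
  rw [h4] at h3
  unfold klTerm
  linarith

/-- At an atom the Radon-Nikodym derivative is the quotient of the masses, so the integral of
`klFun` is a sum. The factor log 2 moves everything to nats, where no division is left. -/
lemma klBits_mul [Countable α] (p q : PMF α) (h : ∀ a, q a = 0 → p a = 0) :
    klBits p q * ENNReal.ofReal (Real.log 2) =
      ∑' a, ENNReal.ofReal (klTerm (p a).toReal (q a).toReal) := by
  let _ : MeasurableSpace α := ⊤
  have hac : p.toMeasure ≪ q.toMeasure := by
    refine MeasureTheory.Measure.AbsolutelyContinuous.mk fun s hs hq => ?_
    rw [PMF.toMeasure_apply_eq_zero_iff _ hs] at hq ⊢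
    refine hq.mono_left ?_
    intro a ha
    rw [PMF.mem_support_iff] at ha ⊢
    exact fun h' => ha (h a h')
  have h2 : ENNReal.ofReal (Real.log 2) ≠ 0 := by
    simpa using Real.log_pos one_lt_two
  unfold klBits
  rw [ENNReal.div_mul_cancel h2 ENNReal.ofReal_ne_top,
    InformationTheory.klDiv_eq_lintegral_klFun_of_ac hac, MeasureTheory.lintegral_countable']
  refine tsum_congr fun a => ?_
  rw [PMF.toMeasure_apply_singleton _ _ (MeasurableSet.singleton a)]
  by_cases hq : q a = 0
  · simp [hq, h a hq, klTerm]
  have hr : p.toMeasure.rnDeriv q.toMeasure a = p a / q a := by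
    have h3 := MeasureTheory.Measure.setLIntegral_rnDeriv hac {a}
    rw [MeasureTheory.lintegral_singleton, PMF.toMeasure_apply_singleton _ _ (MeasurableSet.singleton a),
      PMF.toMeasure_apply_singleton _ _ (MeasurableSet.singleton a)] at h3
    rw [← h3, ENNReal.mul_div_cancel_right hq (PMF.apply_ne_top _ _)]
  rw [hr, ENNReal.toReal_div, klTerm_eq (fun h0 => ?_), ENNReal.ofReal_mul ENNReal.toReal_nonneg,
    ENNReal.ofReal_toReal (PMF.apply_ne_top _ _), mul_comm]
  rw [ENNReal.toReal_eq_zero_iff] at h0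
  exact absurd (h0.resolve_right (PMF.apply_ne_top _ _)) hq

lemma prob_pair_eq_zero (p : PMF Ω) (A : Ω → α) (B : Ω → β) (c : α × β)
    (h : prob p A c.1 * prob p B c.2 = 0) : prob p (fun ω => (A ω, B ω)) c = 0 := by
  rcases mul_eq_zero.1 h with h | h
  · exact le_antisymm (h ▸ prob_pair_le_left p A B c.1 c.2) (prob_nonneg _ _ _)
  · exact le_antisymm (h ▸ prob_pair_le_right p A B c.1 c.2) (prob_nonneg _ _ _)

lemma mutualInfo_mul [Countable α] [Countable β] (p : PMF Ω) (A : Ω → α) (B : Ω → β) :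
    mutualInfo p A B * ENNReal.ofReal (Real.log 2) =
      ∑' c : α × β, ENNReal.ofReal
        (klTerm (prob p (fun ω => (A ω, B ω)) c) (prob p A c.1 * prob p B c.2)) := by
  unfold mutualInfo
  have h1 : ∀ c, (prodPMF (p.map A) (p.map B) c).toReal = prob p A c.1 * prob p B c.2 := by
    rintro ⟨a, b⟩
    rw [prodPMF_apply, ENNReal.toReal_mul]; rfl
  rw [klBits_mul]
  · simp only [h1]; rfl
  · intro c hc
    have h2 := prob_pair_eq_zero p A B c (by rw [← h1, hc]; simp)
    rw [← ofReal_prob, h2, ENNReal.ofReal_zero]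

lemma klTerm_prob_nonneg (p : PMF Ω) (A : Ω → α) (B : Ω → β) (c : α × β) :
    0 ≤ klTerm (prob p (fun ω => (A ω, B ω)) c) (prob p A c.1 * prob p B c.2) :=
  klTerm_nonneg (prob_nonneg _ _ _) (mul_nonneg (prob_nonneg _ _ _) (prob_nonneg _ _ _))
    (prob_pair_eq_zero p A B c)

lemma sum_klTerm_le [Countable α] [Countable β] (p : PMF Ω) (A : Ω → α) (B : Ω → β)
    (s : Finset (α × β)) :
    ENNReal.ofReal (∑ c ∈ s, klTerm (prob p (fun ω => (A ω, B ω)) c) (prob p A c.1 * prob p B c.2))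
      ≤ mutualInfo p A B * ENNReal.ofReal (Real.log 2) := by
  rw [mutualInfo_mul, ENNReal.ofReal_sum_of_nonneg fun c _ => klTerm_prob_nonneg p A B c]
  exact ENNReal.sum_le_tsum s

end Divergence

/-! ### Conditional entropy: the chain rule and bounds on mutual information, valid also for
infinite values. -/

section EntropyInequalities

variable {Ω : Type u} {α : Type v} {β : Type w} {γ : Type z}

lemma ofReal_log_two_ne_zero : ENNReal.ofReal (Real.log 2) ≠ 0 := by
  simpa using Real.log_pos one_lt_two

/-- The summand of the conditional entropy, in nats. -/
def entTerm (p : PMF Ω) (A : Ω → α) (B : Ω → β) (c : α × β) : ℝ :=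
  prob p (fun ω => (A ω, B ω)) c * Real.log (prob p B c.2 / prob p (fun ω => (A ω, B ω)) c)

lemma mul_log_div_nonneg {x y : ℝ} (hx : 0 ≤ x) (h : x ≤ y) : 0 ≤ x * Real.log (y / x) := by
  rcases hx.eq_or_lt with rfl | hx
  · simp
  · exact mul_nonneg hx.le (Real.log_nonneg ((one_le_div hx).2 h))

lemma entTerm_nonneg (p : PMF Ω) (A : Ω → α) (B : Ω → β) (c : α × β) : 0 ≤ entTerm p A B c :=
  mul_log_div_nonneg (prob_nonneg _ _ _) (prob_pair_le_right p A B c.1 c.2)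

lemma condEntropy_mul (p : PMF Ω) (A : Ω → α) (B : Ω → β) :
    condEntropy p A B * ENNReal.ofReal (Real.log 2) =
      ∑' c : α × β, ENNReal.ofReal (entTerm p A B c) := by
  rw [condEntropy, ← ENNReal.tsum_mul_right]
  refine tsum_congr fun c => ?_
  rw [← ENNReal.ofReal_mul' (Real.log_pos one_lt_two).le]
  congr 1
  have := (Real.log_pos one_lt_two).ne'
  simp only [entTerm, Real.logb, prob]
  field_simp

lemma mul_log_two_le_iff {a b : ℝ≥0∞} :
    a * ENNReal.ofReal (Real.log 2) ≤ b * ENNReal.ofReal (Real.log 2) ↔ a ≤ b :=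
  ENNReal.mul_le_mul_iff_left ofReal_log_two_ne_zero ENNReal.ofReal_ne_top

lemma mul_log_two_inj {a b : ℝ≥0∞} :
    a * ENNReal.ofReal (Real.log 2) = b * ENNReal.ofReal (Real.log 2) ↔ a = b :=
  ENNReal.mul_left_inj ofReal_log_two_ne_zero ENNReal.ofReal_ne_top

/-- Refining a variable `S` with weights `W = ∑ w t` and `X = ∑ x t` costs at most the entropy of
the refinement. -/
lemma tsum_klTerm_le {x w : α → ℝ} {X W p : ℝ} (hx : ∀ t, 0 ≤ x t) (hw : ∀ t, 0 ≤ w t)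
    (hX : HasSum x X) (hW : HasSum w W) (hp : 0 ≤ p) (h : ∀ t, p * w t = 0 → x t = 0) :
    ∑' t, ENNReal.ofReal (klTerm (x t) (p * w t)) ≤
      ENNReal.ofReal (klTerm X (p * W)) + ∑' t, ENNReal.ofReal (x t * Real.log (W / w t)) := by
  by_cases htop : ∑' t, ENNReal.ofReal (x t * Real.log (W / w t)) = ∞
  · rw [htop]; simp
  have hxX : ∀ t, x t ≤ X := fun t => le_hasSum hX t fun _ _ => hx _
  have hwW : ∀ t, w t ≤ W := fun t => le_hasSum hW t fun _ _ => hw _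
  have he : ∀ t, 0 ≤ x t * Real.log (W / w t) := fun t => by
    rcases (hw t).eq_or_lt with h0 | h0
    · rw [← h0]; simp
    · exact mul_nonneg (hx t) (Real.log_nonneg ((one_le_div h0).2 (hwW t)))
  have hes : Summable fun t => x t * Real.log (W / w t) := by
    have := ENNReal.summable_toReal htop
    simpa only [ENNReal.toReal_ofReal (he _)] using this
  have hpt : ∀ t, klTerm (x t) (p * w t) ≤
      x t * Real.log (X / (p * W)) + x t * Real.log (W / w t) + p * w t - x t := by
    intro t
    rcases (hx t).eq_or_lt with h0 | h0
    · simp [klTerm, ← h0]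
    have hpw : p * w t ≠ 0 := fun h' => h0.ne' (h t h')
    have hp' : 0 < p := hp.lt_of_ne (left_ne_zero_of_mul hpw).symm
    have hw' : 0 < w t := (hw t).lt_of_ne (right_ne_zero_of_mul hpw).symm
    have hW' : 0 < W := hw'.trans_le (hwW t)
    have hX' : 0 < X := h0.trans_le (hxX t)
    -- The only loss is replacing `x t` by its upper bound `X` inside the logarithm.
    have h1 : Real.log (x t / (p * w t)) ≤ Real.log (X / (p * W)) + Real.log (W / w t) := by
      rw [← Real.log_mul (by positivity) (by positivity)]
      refine Real.log_le_log (by positivity) ?_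
      rw [show X / (p * W) * (W / w t) = X / (p * w t) by field_simp]
      have := hxX t
      gcongr
    have h2 := mul_le_mul_of_nonneg_left h1 h0.le
    unfold klTerm
    linarith
  have hsum : HasSum (fun t => x t * Real.log (X / (p * W)) + x t * Real.log (W / w t) + p * w t
      - x t) (klTerm X (p * W) + ∑' t, x t * Real.log (W / w t)) := by
    have h1 := (((hX.mul_right (Real.log (X / (p * W)))).add hes.hasSum).add
      (hW.mul_left p)).sub hX
    rwa [show X * Real.log (X / (p * W)) + ∑' t, x t * Real.log (W / w t) + p * W - X =
      klTerm X (p * W) + ∑' t, x t * Real.log (W / w t) by unfold klTerm; ring] at h1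
  have hkl : ∀ t, 0 ≤ klTerm (x t) (p * w t) := fun t =>
    klTerm_nonneg (hx t) (mul_nonneg hp (hw t)) (h t)
  have hs : Summable fun t => klTerm (x t) (p * w t) :=
    Summable.of_nonneg_of_le hkl hpt hsum.summable
  rw [← ENNReal.ofReal_tsum_of_nonneg hkl hs, ← ENNReal.ofReal_tsum_of_nonneg he hes]
  refine le_trans (ENNReal.ofReal_le_ofReal ?_) ENNReal.ofReal_add_le
  exact (hs.tsum_le_tsum hpt hsum.summable).trans_eq hsum.tsum_eq

/-- `I(Y; T, S) ≤ I(Y; S) + H(T | S)`. -/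
lemma mutualInfo_pair_le [Countable α] [Countable β] [Countable γ] (p : PMF Ω) (Y : Ω → α)
    (T : Ω → β) (S : Ω → γ) :
    mutualInfo p Y (fun ω => (T ω, S ω)) ≤ mutualInfo p Y S + condEntropy p T S := by
  rw [← mul_log_two_le_iff, add_mul, mutualInfo_mul, mutualInfo_mul, condEntropy_mul,
    ENNReal.tsum_prod']
  simp_rw [ENNReal.tsum_prod']
  have key : ∀ y s, ∑' t, ENNReal.ofReal (klTerm (prob p (fun ω => (Y ω, (T ω, S ω))) (y, (t, s)))
        (prob p Y y * prob p (fun ω => (T ω, S ω)) (t, s))) ≤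
      ENNReal.ofReal (klTerm (prob p (fun ω => (Y ω, S ω)) (y, s)) (prob p Y y * prob p S s)) +
      ∑' t, ENNReal.ofReal (prob p (fun ω => (Y ω, (T ω, S ω))) (y, (t, s)) *
        Real.log (prob p S s / prob p (fun ω => (T ω, S ω)) (t, s))) := by
    intro y s
    refine tsum_klTerm_le (fun _ => prob_nonneg _ _ _) (fun _ => prob_nonneg _ _ _) ?_
      (hasSum_prob_fst p T S s) (prob_nonneg _ _ _)
      (fun t => prob_pair_eq_zero p Y (fun ω => (T ω, S ω)) (y, (t, s)))
    have h1 := hasSum_prob_fst p T (fun ω => (Y ω, S ω)) (y, s)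
    convert h1 using 2 with t
    exact (prob_comp_injective p (fun ω => (Y ω, (T ω, S ω)))
      (f := fun c : α × β × γ => (c.2.1, (c.1, c.2.2)))
      (fun c d h => by simp only [Prod.mk.injEq] at h; ext <;> simp [h]) (y, (t, s))).symm
  calc _ ≤ ∑' y, ∑' s, (ENNReal.ofReal (klTerm (prob p (fun ω => (Y ω, S ω)) (y, s))
          (prob p Y y * prob p S s)) +
        ∑' t, ENNReal.ofReal (prob p (fun ω => (Y ω, (T ω, S ω))) (y, (t, s)) *
          Real.log (prob p S s / prob p (fun ω => (T ω, S ω)) (t, s)))) := by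
        refine ENNReal.tsum_le_tsum fun y => ?_
        rw [ENNReal.tsum_comm]
        exact ENNReal.tsum_le_tsum fun s => key y s
    _ = _ := by
        simp_rw [ENNReal.tsum_add]
        congr 1
        rw [ENNReal.tsum_comm, ENNReal.tsum_comm (f := fun t s => ENNReal.ofReal
          (entTerm p T S (t, s)))]
        refine tsum_congr fun s => ?_
        rw [ENNReal.tsum_comm]
        refine tsum_congr fun t => ?_
        have h0 : prob p (fun ω => (T ω, S ω)) (t, s) ≤ prob p S s := prob_pair_le_right p T S t s
        -- The logarithm does not involve `y`, so summing over `y` replaces P(y,t,s) by P(t,s).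
        simp_rw [ENNReal.ofReal_mul (prob_nonneg _ _ _), ofReal_prob]
        rw [ENNReal.tsum_mul_right, tsum_map_fst, entTerm,
          ENNReal.ofReal_mul (prob_nonneg _ _ _), ofReal_prob]

/-- `I(Y; T) ≤ I(Y; S) + H(T | S)`. -/
lemma mutualInfo_le_add_condEntropy [Countable α] [Countable β] [Countable γ] (p : PMF Ω)
    (Y : Ω → α) (T : Ω → β) (S : Ω → γ) :
    mutualInfo p Y T ≤ mutualInfo p Y S + condEntropy p T S :=
  (mutualInfo_comp_right_le p Y (fun ω => (T ω, S ω)) Prod.fst).trans (mutualInfo_pair_le p Y T S)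

/-- Entropy is conditional entropy given a constant; unconditional facts are obtained below by
specializing conditional ones. -/
lemma condEntropy_unit (p : PMF Ω) (A : Ω → α) : condEntropy p A (fun _ => ()) = entropy p A := by
  unfold condEntropy entropy
  rw [ENNReal.tsum_prod']
  refine tsum_congr fun a => ?_
  rw [tsum_eq_single () (by simp)]
  have h1 : (p.map (fun ω => (A ω, ()))) (a, ()) = p.map A a := by
    have := prob_comp_injective p A (f := fun a => (a, ())) (fun a b h => by simpa using h) a
    rwa [← ENNReal.toReal_eq_toReal_iff' (PMF.apply_ne_top _ _) (PMF.apply_ne_top _ _)]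
  have h2 : (p.map (fun _ => ())) () = 1 := by
    rw [show (fun _ : Ω => ()) = Function.const Ω () from rfl, PMF.map_const]
    exact PMF.pure_apply_self _
  rw [h1, h2, ENNReal.toReal_one]

lemma mutualInfo_unit (p : PMF Ω) (A : Ω → α) : mutualInfo p A (fun _ => ()) = 0 := by
  refine mutualInfo_eq_zero _ _ _ ?_
  rw [show (fun _ : Ω => ()) = Function.const Ω () from rfl, PMF.map_const, prodPMF]
  simp only [PMF.pure_map]
  change _ = PMF.bind (p.map A) (PMF.pure ∘ fun a => (a, ()))
  rw [PMF.bind_pure_comp, PMF.map_comp]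
  rfl

/-- `I(Y; A) ≤ H(A)`. -/
lemma mutualInfo_le_entropy [Countable α] [Countable β] (p : PMF Ω) (Y : Ω → α) (A : Ω → β) :
    mutualInfo p Y A ≤ entropy p A := by
  have := mutualInfo_le_add_condEntropy p Y A (fun _ => ())
  rwa [mutualInfo_unit, zero_add, condEntropy_unit] at this

lemma condEntropy_comp_equiv {α' β' : Type*} (p : PMF Ω) (A : Ω → α) (B : Ω → β) (f : α ≃ α')
    (g : β ≃ β') : condEntropy p (fun ω => f (A ω)) (fun ω => g (B ω)) = condEntropy p A B := by
  rw [← mul_log_two_inj, condEntropy_mul, condEntropy_mul,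
    ← (Equiv.prodCongr f g).tsum_eq]
  refine tsum_congr fun c => ?_
  unfold entTerm
  have h1 := prob_comp_injective p (fun ω => (A ω, B ω)) (Equiv.prodCongr f g).injective c
  have h2 := prob_comp_injective p B g.injective c.2
  simp only [Equiv.prodCongr_apply, Prod.map] at h1 h2 ⊢
  rw [h1, h2]

/-- The chain rule `H(A, B | C) = H(A | C) + H(B | A, C)`. -/
lemma condEntropy_chain (p : PMF Ω) (A : Ω → α) (B : Ω → β) (C : Ω → γ) :
    condEntropy p (fun ω => (A ω, B ω)) C =
      condEntropy p A C + condEntropy p B (fun ω => (A ω, C ω)) := by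
  rw [← mul_log_two_inj, add_mul, condEntropy_mul, condEntropy_mul, condEntropy_mul]
  have e1 : ∀ a b c, prob p (fun ω => ((A ω, B ω), C ω)) ((a, b), c) =
      prob p (fun ω => (B ω, (A ω, C ω))) (b, (a, c)) := fun a b c =>
    prob_comp_injective p (fun ω => (B ω, (A ω, C ω)))
      (f := fun d : β × α × γ => ((d.2.1, d.1), d.2.2))
      (fun c d h => by simp only [Prod.mk.injEq] at h; ext <;> simp [h]) (b, (a, c))
  have key : ∀ a b c, ENNReal.ofReal (entTerm p (fun ω => (A ω, B ω)) C ((a, b), c)) =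
      p.map (fun ω => (B ω, (A ω, C ω))) (b, (a, c)) *
        ENNReal.ofReal (Real.log (prob p C c / prob p (fun ω => (A ω, C ω)) (a, c))) +
      ENNReal.ofReal (entTerm p B (fun ω => (A ω, C ω)) (b, (a, c))) := by
    intro a b c
    rw [← ofReal_prob, ← ENNReal.ofReal_mul (prob_nonneg _ _ _), ← ENNReal.ofReal_add]
    · congr 1
      unfold entTerm
      simp only
      rw [e1]
      have h1 : prob p (fun ω => (B ω, (A ω, C ω))) (b, (a, c)) ≤
          prob p (fun ω => (A ω, C ω)) (a, c) := prob_pair_le_right p B (fun ω => (A ω, C ω)) b (a, c)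
      have h2 : prob p (fun ω => (A ω, C ω)) (a, c) ≤ prob p C c := prob_pair_le_right p A C a c
      rcases (prob_nonneg p (fun ω => (B ω, (A ω, C ω))) (b, (a, c))).eq_or_lt with h0 | h0
      · rw [← h0]; simp
      · rw [← mul_add, ← Real.log_mul (by have := h0.trans_le h1; have := this.trans_le h2; positivity)
          (by have := h0.trans_le h1; positivity)]
        have := h0.trans_le h1
        congr 2
        field_simp
    · have h2 : prob p (fun ω => (A ω, C ω)) (a, c) ≤ prob p C c := prob_pair_le_right p A C a c
      rcases (prob_nonneg p (fun ω => (A ω, C ω)) (a, c)).eq_or_lt with h0 | h0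
      · rw [← h0]; simp
      · exact mul_nonneg (prob_nonneg _ _ _) (Real.log_nonneg ((one_le_div h0).2 h2))
    · exact entTerm_nonneg _ _ _ _
  simp_rw [ENNReal.tsum_prod', key, ENNReal.tsum_add]
  congr 1
  · refine tsum_congr fun a => ?_
    rw [ENNReal.tsum_comm]
    refine tsum_congr fun c => ?_
    rw [ENNReal.tsum_mul_right, tsum_map_fst, entTerm, ENNReal.ofReal_mul (prob_nonneg _ _ _),
      ofReal_prob]
  · rw [ENNReal.tsum_comm]

/-- Conditional entropy of a variable with finitely many values is finite. -/
lemma condEntropy_ne_top [Finite α] (p : PMF Ω) (A : Ω → α) (B : Ω → β) :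
    condEntropy p A B ≠ ∞ := by
  have := Fintype.ofFinite α
  have h : condEntropy p A B * ENNReal.ofReal (Real.log 2) ≤ Fintype.card α := by
    rw [condEntropy_mul, ENNReal.tsum_prod', tsum_fintype]
    calc _ ≤ ∑ _a : α, (1 : ℝ≥0∞) := by
          refine Finset.sum_le_sum fun a _ => ?_
          -- Termwise x log(y/x) ≤ y - x ≤ y with y = P(B = b), so each value of `A` contributes at
          -- most one nat.
          rw [← PMF.tsum_coe (p.map B)]
          refine ENNReal.tsum_le_tsum fun b => ?_
          rw [← ofReal_prob]
          refine ENNReal.ofReal_le_ofReal ?_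
          unfold entTerm
          rcases (prob_nonneg p (fun ω => (A ω, B ω)) (a, b)).eq_or_lt with h0 | h0
          · rw [← h0]; simpa using prob_nonneg p B b
          · have h1 := h0.trans_le (prob_pair_le_right p A B a b)
            have h2 := Real.log_le_sub_one_of_pos
              (show 0 < prob p B b / prob p (fun ω => (A ω, B ω)) (a, b) by positivity)
            have h3 := mul_le_mul_of_nonneg_left h2 h0.le
            rw [mul_sub, mul_div_cancel₀ _ h0.ne'] at h3
            simp only
            linarith
      _ = _ := by simp
  intro htop
  rw [htop, ENNReal.top_mul ofReal_log_two_ne_zero] at h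
  exact absurd h (by simp)

end EntropyInequalities

/-! ### Representations drawn from a kernel, and time sharing. -/

section Representations

variable {Ω : Type u} {α : Type v} {β : Type w} {γ : Type*} {𝒴 : Type z}

/-- The joint law of `ω` and of a representation drawn from `W ω`. -/
def joint (P : PMF Ω) (W : Ω → PMF 𝒴) : PMF (Ω × 𝒴) :=
  P.bind fun a => (W a).map fun y => (a, y)

/-- The information `I(Y; C)` that a representation reveals about `C`. -/
def repInfo (P : PMF Ω) (W : Ω → PMF 𝒴) (C : Ω → γ) : ℝ≥0∞ :=
  mutualInfo (joint P W) (fun ω => ω.2) (fun ω => C ω.1)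

lemma joint_map_fst (P : PMF Ω) (W : Ω → PMF 𝒴) : (joint P W).map Prod.fst = P := by
  unfold joint
  rw [PMF.map_bind]
  simp only [PMF.map_comp]
  change P.bind (fun a => (W a).map (Function.const 𝒴 a)) = P
  simp only [PMF.map_const]
  exact PMF.bind_pure P

lemma joint_map_comp (P : PMF Ω) (W : Ω → PMF 𝒴) (C : Ω → γ) :
    (joint P W).map (fun ω => C ω.1) = P.map C := by
  conv_rhs => rw [← joint_map_fst P W, PMF.map_comp]
  rfl

lemma joint_prob (P : PMF Ω) (W : Ω → PMF 𝒴) (C : Ω → γ) :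
    prob (joint P W) (fun ω => C ω.1) = prob P C := by
  unfold prob
  rw [joint_map_comp]

lemma joint_condEntropy (P : PMF Ω) (W : Ω → PMF 𝒴) (A : Ω → α) (B : Ω → β) :
    condEntropy (joint P W) (fun ω => A ω.1) (fun ω => B ω.1) = condEntropy P A B := by
  unfold condEntropy
  rw [joint_map_comp P W B, joint_map_comp P W (fun ω => (A ω, B ω))]

lemma joint_entropy (P : PMF Ω) (W : Ω → PMF 𝒴) (A : Ω → α) :
    entropy (joint P W) (fun ω => A ω.1) = entropy P A := by
  unfold entropy
  rw [joint_map_comp P W A]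

lemma joint_map_snd (P : PMF Ω) (W : Ω → PMF 𝒴) :
    (joint P W).map (fun ω => ω.2) = P.bind W := by
  unfold joint
  rw [PMF.map_bind]
  simp only [PMF.map_comp]
  change P.bind (fun a => (W a).map id) = _
  simp only [PMF.map_id]

lemma joint_map_pair (P : PMF Ω) (W : Ω → PMF 𝒴) (C : Ω → γ) :
    (joint P W).map (fun ω => (ω.2, C ω.1)) = P.bind fun a => (W a).map fun y => (y, C a) := by
  unfold joint
  rw [PMF.map_bind]
  simp only [PMF.map_comp]
  rfl

/-- A representation that looks at `C` only. -/
lemma joint_map_pair_comp (P : PMF Ω) (C : Ω → γ) (w : γ → PMF 𝒴) (y : 𝒴) (c : γ) :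
    (joint P fun ω => w (C ω)).map (fun ω => (ω.2, C ω.1)) (y, c) = P.map C c * w c y := by
  rw [joint_map_pair]
  change (P.bind ((fun c => (w c).map fun y => (y, c)) ∘ C)) _ = _
  rw [← PMF.bind_map, PMF.bind_apply, tsum_eq_single c]
  · congr 1
    have := prob_comp_injective (w c) id (f := fun y => (y, c)) (fun a b h => by simpa using h) y
    rw [prob, prob, PMF.map_id,
      ENNReal.toReal_eq_toReal_iff' (PMF.apply_ne_top _ _) (PMF.apply_ne_top _ _)] at this
    exact this
  · intro c' hc'
    simp [Ne.symm hc']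

lemma repInfo_symm (P : PMF Ω) (W : Ω → PMF 𝒴) (C : Ω → γ) :
    repInfo P W C = mutualInfo (joint P W) (fun ω => C ω.1) (fun ω => ω.2) :=
  mutualInfo_symm _ _ _

lemma repInfo_comp_le (P : PMF Ω) (W : Ω → PMF 𝒴) (C : Ω → β) (f : β → γ) :
    repInfo P W (fun ω => f (C ω)) ≤ repInfo P W C :=
  mutualInfo_comp_right_le (joint P W) (fun ω => ω.2) (fun ω => C ω.1) f

lemma repInfo_pair_le [Countable 𝒴] [Countable α] [Countable β] (P : PMF Ω) (W : Ω → PMF 𝒴)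
    (A : Ω → α) (B : Ω → β) :
    repInfo P W (fun ω => (A ω, B ω)) ≤ repInfo P W B + condEntropy P A B := by
  have := mutualInfo_pair_le (joint P W) (fun ω => ω.2) (fun ω => A ω.1) (fun ω => B ω.1)
  rwa [joint_condEntropy] at this

lemma repInfo_le_add_condEntropy [Countable 𝒴] [Countable α] [Countable β] (P : PMF Ω)
    (W : Ω → PMF 𝒴) (A : Ω → α) (B : Ω → β) :
    repInfo P W A ≤ repInfo P W B + condEntropy P A B :=
  (repInfo_comp_le P W (fun ω => (A ω, B ω)) Prod.fst).trans (repInfo_pair_le P W A B)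

lemma repInfo_le_entropy [Countable 𝒴] [Countable α] (P : PMF Ω) (W : Ω → PMF 𝒴) (A : Ω → α) :
    repInfo P W A ≤ entropy P A := by
  have := mutualInfo_le_entropy (joint P W) (fun ω => ω.2) (fun ω => A ω.1)
  rwa [joint_entropy] at this

/-- The information is at most H(Y), which is finite on a finite alphabet. This supplies finite
mixing weights when the entropies of the source are infinite. -/
lemma repInfo_ne_top [Finite 𝒴] [Countable α] (P : PMF Ω) (W : Ω → PMF 𝒴) (A : Ω → α) :
    repInfo P W A ≠ ∞ := by
  rw [repInfo_symm]
  refine ne_top_of_le_ne_top ?_ (mutualInfo_le_entropy _ _ _)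
  rw [← condEntropy_unit]
  exact condEntropy_ne_top _ _ _

/-- A biased coin. -/
def coin (θ : ℝ≥0) (hθ : θ ≤ 1) : PMF Bool :=
  PMF.ofFintype (fun b => bif b then (θ : ℝ≥0∞) else (1 - θ : ℝ≥0))
    (by simp [add_tsub_cancel_of_le (ENNReal.coe_le_one_iff.2 hθ)])

/-- The representation that reveals `W₁ ω` with probability `θ` and `W₀ ω` otherwise. -/
def timeShare {𝒴' : Type*} (θ : ℝ≥0) (hθ : θ ≤ 1) (W₁ : Ω → PMF 𝒴) (W₀ : Ω → PMF 𝒴') (ω : Ω) :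
    PMF (𝒴 ⊕ 𝒴') :=
  (coin θ hθ).bind fun b => bif b then (W₁ ω).map Sum.inl else (W₀ ω).map Sum.inr

variable {𝒴' : Type*}

lemma map_inl_inl (p : PMF 𝒴) (y : 𝒴) : p.map (Sum.inl : 𝒴 → 𝒴 ⊕ 𝒴') (Sum.inl y) = p y := by
  rw [PMF.map_apply, tsum_eq_single y]
  · simp
  · intro y' h; simp [Ne.symm h]

lemma map_inr_inr (p : PMF 𝒴') (y : 𝒴') : p.map (Sum.inr : 𝒴' → 𝒴 ⊕ 𝒴') (Sum.inr y) = p y := by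
  rw [PMF.map_apply, tsum_eq_single y]
  · simp
  · intro y' h; simp [Ne.symm h]

lemma timeShare_inl (θ : ℝ≥0) (hθ : θ ≤ 1) (W₁ : Ω → PMF 𝒴) (W₀ : Ω → PMF 𝒴') (ω : Ω) (y : 𝒴) :
    timeShare θ hθ W₁ W₀ ω (Sum.inl y) = θ * W₁ ω y := by
  rw [timeShare, PMF.bind_apply, tsum_fintype]
  simp [map_inl_inl, coin, -PMF.map_apply]
  simp [PMF.map_apply]

lemma timeShare_inr (θ : ℝ≥0) (hθ : θ ≤ 1) (W₁ : Ω → PMF 𝒴) (W₀ : Ω → PMF 𝒴') (ω : Ω) (y : 𝒴') :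
    timeShare θ hθ W₁ W₀ ω (Sum.inr y) = (1 - θ : ℝ≥0) * W₀ ω y := by
  rw [timeShare, PMF.bind_apply, tsum_fintype]
  simp [map_inr_inr, coin, -PMF.map_apply]
  simp [PMF.map_apply]

lemma joint_map_pair_apply (P : PMF Ω) (W : Ω → PMF 𝒴) (C : Ω → γ) (y : 𝒴) (c : γ) :
    (joint P W).map (fun ω => (ω.2, C ω.1)) (y, c) =
      ∑' ω, P ω * (({ω | C ω = c} : Set Ω).indicator (fun ω => W ω y) ω) := by
  rw [joint_map_pair, PMF.bind_apply]
  refine tsum_congr fun ω => ?_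
  congr 1
  rw [PMF.map_apply, tsum_eq_single y]
  · by_cases h : C ω = c
    · simp [h]
    · simp [h, Ne.symm h]
  · intro y' h; simp [Ne.symm h]

lemma klTerm_smul (θ x y : ℝ) : klTerm (θ * x) (θ * y) = θ * klTerm x y := by
  unfold klTerm
  by_cases h : θ = 0
  · simp [h]
  · rw [mul_div_mul_left _ _ h]; ring

/-- The coin is independent of the source and visible in `Y`, because the two alphabets are kept
disjoint. On each summand both the joint law and the product law scale by the coin probability, and
`klTerm` is homogeneous. -/
lemma repInfo_timeShare [Countable 𝒴] [Countable 𝒴'] [Countable γ] (P : PMF Ω) (θ : ℝ≥0)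
    (hθ : θ ≤ 1) (W₁ : Ω → PMF 𝒴) (W₀ : Ω → PMF 𝒴') (C : Ω → γ) :
    repInfo P (timeShare θ hθ W₁ W₀) C =
      θ * repInfo P W₁ C + (1 - θ : ℝ≥0) * repInfo P W₀ C := by
  unfold repInfo
  rw [← mul_log_two_inj, add_mul, mul_assoc, mul_assoc, mutualInfo_mul, mutualInfo_mul,
    mutualInfo_mul, ENNReal.tsum_prod',
    (Summable.tsum_sum ENNReal.summable ENNReal.summable :)]
  simp_rw [joint_prob]
  have h1 : ∀ y c, prob (joint P (timeShare θ hθ W₁ W₀)) (fun ω => (ω.2, C ω.1)) (Sum.inl y, c) =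
      θ * prob (joint P W₁) (fun ω => (ω.2, C ω.1)) (y, c) := by
    intro y c
    rw [prob, prob, joint_map_pair_apply, joint_map_pair_apply, ← ENNReal.coe_toReal,
      ← ENNReal.toReal_mul, ← ENNReal.tsum_mul_left]
    congr 1
    refine tsum_congr fun ω => ?_
    by_cases h : C ω = c
    · simp [h, timeShare_inl, mul_left_comm]
    · simp [h]
  have h2 : ∀ y c, prob (joint P (timeShare θ hθ W₁ W₀)) (fun ω => (ω.2, C ω.1)) (Sum.inr y, c) =
      (1 - θ : ℝ≥0) * prob (joint P W₀) (fun ω => (ω.2, C ω.1)) (y, c) := by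
    intro y c
    rw [prob, prob, joint_map_pair_apply, joint_map_pair_apply, ← ENNReal.coe_toReal,
      ← ENNReal.toReal_mul, ← ENNReal.tsum_mul_left]
    congr 1
    refine tsum_congr fun ω => ?_
    by_cases h : C ω = c
    · simp only [h, Set.mem_ofPred_eq, Set.indicator_of_mem, timeShare_inr]
      rw [mul_left_comm]
    · simp [h]
  have h3 : ∀ y, prob (joint P (timeShare θ hθ W₁ W₀)) (fun ω => ω.2) (Sum.inl y) =
      θ * prob (joint P W₁) (fun ω => ω.2) y := by
    intro y
    simp only [prob, joint_map_snd, PMF.bind_apply, timeShare_inl]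
    rw [← ENNReal.coe_toReal, ← ENNReal.toReal_mul, ← ENNReal.tsum_mul_left]
    simp only [mul_left_comm]
  have h4 : ∀ y, prob (joint P (timeShare θ hθ W₁ W₀)) (fun ω => ω.2) (Sum.inr y) =
      (1 - θ : ℝ≥0) * prob (joint P W₀) (fun ω => ω.2) y := by
    intro y
    simp only [prob, joint_map_snd, PMF.bind_apply, timeShare_inr]
    rw [← ENNReal.coe_toReal, ← ENNReal.toReal_mul, ← ENNReal.tsum_mul_left]
    simp only [mul_left_comm]
  simp_rw [h1, h2, h3, h4, mul_assoc, klTerm_smul, ENNReal.tsum_prod', ← ENNReal.tsum_mul_left]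
  congr 1 <;>
  · refine tsum_congr fun y => tsum_congr fun c => ?_
    rw [ENNReal.ofReal_mul (NNReal.coe_nonneg _), ENNReal.ofReal_coe_nnreal]

end Representations

/-! ### The trade-off as a concave function of its two budgets. -/

section Frontier

variable {Ω : Type u} {α : Type v} {β : Type w} {γ : Type z}

/-- The trade-off `sup { I(Y; T) : I(Y; A) ≤ ρ, I(Y; B) ≤ σ }`. -/
def frontier (P : PMF Ω) (A : Ω → α) (B : Ω → β) (T : Ω → γ) (ρ σ : ℝ≥0∞) : ℝ≥0∞ :=
  sSup {i : ℝ≥0∞ | ∃ (𝒴 : Type) (_ : Countable 𝒴) (W : Ω → PMF 𝒴),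
    repInfo P W A ≤ ρ ∧ repInfo P W B ≤ σ ∧ i = repInfo P W T}

variable {P : PMF Ω} {A : Ω → α} {B : Ω → β} {T : Ω → γ} {ρ σ : ℝ≥0∞}

lemma le_frontier {𝒴 : Type} [h : Countable 𝒴] (W : Ω → PMF 𝒴) (hA : repInfo P W A ≤ ρ)
    (hB : repInfo P W B ≤ σ) : repInfo P W T ≤ frontier P A B T ρ σ :=
  le_sSup ⟨𝒴, h, W, hA, hB, rfl⟩

lemma frontier_le {x : ℝ≥0∞} (h : ∀ (𝒴 : Type) [Countable 𝒴] (W : Ω → PMF 𝒴),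
    repInfo P W A ≤ ρ → repInfo P W B ≤ σ → repInfo P W T ≤ x) : frontier P A B T ρ σ ≤ x := by
  refine sSup_le ?_
  rintro i ⟨𝒴, h𝒴, W, hA, hB, rfl⟩
  exact h 𝒴 W hA hB

lemma frontier_mono {ρ' σ' : ℝ≥0∞} (hρ : ρ ≤ ρ') (hσ : σ ≤ σ') :
    frontier P A B T ρ σ ≤ frontier P A B T ρ' σ' :=
  frontier_le fun _ _ W hA hB => le_frontier W (hA.trans hρ) (hB.trans hσ)

lemma frontier_comm : frontier P A B T ρ σ = frontier P B A T σ ρ :=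
  le_antisymm (frontier_le fun _ _ W hA hB => le_frontier W hB hA)
    (frontier_le fun _ _ W hA hB => le_frontier W hB hA)

/-- The trade-off is concave. -/
lemma frontier_concave [Countable α] [Countable β] [Countable γ] (θ : ℝ≥0) (hθ : θ ≤ 1)
    (ρ₁ σ₁ ρ₀ σ₀ : ℝ≥0∞) :
    θ * frontier P A B T ρ₁ σ₁ + (1 - θ : ℝ≥0) * frontier P A B T ρ₀ σ₀ ≤
      frontier P A B T (θ * ρ₁ + (1 - θ : ℝ≥0) * ρ₀) (θ * σ₁ + (1 - θ : ℝ≥0) * σ₀) := by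
  unfold frontier
  -- A constant representation meets every budget, so both suprema are over nonempty sets and can be
  -- added.
  have hne : ∀ ρ σ : ℝ≥0∞, {i : ℝ≥0∞ | ∃ (𝒴 : Type) (_ : Countable 𝒴) (W : Ω → PMF 𝒴),
    repInfo P W A ≤ ρ ∧ repInfo P W B ≤ σ ∧ i = repInfo P W T}.Nonempty := by
    intro ρ σ
    refine ⟨_, Unit, inferInstance, fun _ => PMF.pure (), ?_, ?_, rfl⟩
    · rw [repInfo_symm]; exact (mutualInfo_unit _ _).trans_le zero_le
    · rw [repInfo_symm]; exact (mutualInfo_unit _ _).trans_le zero_le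
  rw [ENNReal.mul_sSup, ENNReal.mul_sSup]
  refine ENNReal.biSup_add_biSup_le (hne _ _) (hne _ _) ?_
  rintro i ⟨𝒴, h𝒴, W, hA, hB, rfl⟩ j ⟨𝒴', h𝒴', W', hA', hB', rfl⟩
  rw [← repInfo_timeShare P θ hθ]
  refine le_sSup ⟨𝒴 ⊕ 𝒴', inferInstance, _, ?_, ?_, rfl⟩
  · rw [repInfo_timeShare]; gcongr
  · rw [repInfo_timeShare]; gcongr

/-- `I(Y; T) ≤ I(Y; A) + H(T | A)`. -/
lemma frontier_le_left [Countable α] [Countable γ] :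
    frontier P A B T ρ σ ≤ condEntropy P T A + ρ :=
  frontier_le fun _ _ W hA _ => (repInfo_le_add_condEntropy P W T A).trans
    ((add_comm _ _).trans_le (by gcongr))

/-- A constraint on `I(Y; A)` also bounds `I(Y; B)`. -/
lemma frontier_le_of_condEntropy [Countable α] [Countable β] {σ' : ℝ≥0∞} :
    frontier P A B T ρ σ' ≤ frontier P A B T ρ (ρ + condEntropy P B A) :=
  frontier_le fun _ _ W hA _ => le_frontier W hA
    ((repInfo_le_add_condEntropy P W B A).trans (by gcongr))

end Frontier

/-! ### The race of exponential clocks and the decoder weight. -/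

section ExponentialRace

/-- The law of a unit-rate exponential random variable. -/
def expLaw : Measure ℝ :=
  (volume.restrict (Set.Ioi 0)).withDensity fun x => ENNReal.ofReal (Real.exp (-x))

lemma lintegral_expLaw (h : ℝ → ℝ≥0∞) (hh : Measurable h) :
    ∫⁻ x, h x ∂expLaw = ∫⁻ x in Set.Ioi 0, ENNReal.ofReal (Real.exp (-x)) * h x := by
  rw [expLaw, lintegral_withDensity_eq_lintegral_mul _ (by fun_prop) hh]
  rfl

lemma lintegral_Ioi_eq {f : ℝ → ℝ} {a I : ℝ} (hf : ∀ x ∈ Set.Ioi a, 0 ≤ f x)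
    (h : ∫ x in Set.Ioi a, f x = I) (hI : I ≠ 0) :
    ∫⁻ x in Set.Ioi a, ENNReal.ofReal (f x) = ENNReal.ofReal I := by
  have hint : IntegrableOn f (Set.Ioi a) := Integrable.of_integral_ne_zero (by rw [h]; exact hI)
  rw [← h, ofReal_integral_eq_lintegral_ofReal hint]
  exact (ae_restrict_iff' measurableSet_Ioi).2 (ae_of_all _ hf)

lemma expLaw_Ioi {y : ℝ} (hy : 0 ≤ y) : expLaw (Set.Ioi y) = ENNReal.ofReal (Real.exp (-y)) := by
  rw [expLaw, withDensity_apply _ measurableSet_Ioi, Measure.restrict_restrict measurableSet_Ioi,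
    Set.inter_eq_left.2 (Set.Ioi_subset_Ioi hy)]
  exact lintegral_Ioi_eq (fun x _ => (Real.exp_pos _).le) (integral_exp_neg_Ioi y)
    (Real.exp_pos _).ne'

instance : IsProbabilityMeasure expLaw where
  measure_univ := by
    have h := expLaw_Ioi le_rfl
    rw [neg_zero, Real.exp_zero, ENNReal.ofReal_one] at h
    rw [← h, expLaw, withDensity_apply _ MeasurableSet.univ, withDensity_apply _ measurableSet_Ioi,
      Measure.restrict_univ, Measure.restrict_restrict measurableSet_Ioi, Set.inter_self]

variable {n : ℕ}

/-- The law of independent unit-rate exponential clocks. -/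
def clocks (n : ℕ) : Measure (Fin (n + 1) → ℝ) := Measure.pi fun _ => expLaw

instance : IsProbabilityMeasure (clocks n) := by unfold clocks; infer_instance

/-- The event that clock `k`, running at speed `q k`, rings before all other clocks. -/
def race (q : Fin (n + 1) → ℝ) (k : Fin (n + 1)) : Set (Fin (n + 1) → ℝ) :=
  {u | ∀ j, j ≠ k → q j * u k < q k * u j}

lemma measurableSet_race (q : Fin (n + 1) → ℝ) (k : Fin (n + 1)) : MeasurableSet (race q k) := by
  have : race q k = ⋂ j, ⋂ (_ : j ≠ k), {u | q j * u k < q k * u j} := by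
    ext u; simp [race]
  rw [this]
  refine MeasurableSet.iInter fun j => MeasurableSet.iInter fun _ => ?_
  exact measurableSet_lt (by fun_prop) (by fun_prop)

lemma race_disjoint (q : Fin (n + 1) → ℝ) {j k : Fin (n + 1)} {u : Fin (n + 1) → ℝ}
    (hj : u ∈ race q j) (hk : u ∈ race q k) : j = k := by
  by_contra h
  exact lt_asymm (hj k (Ne.symm h)) (hk j h)

/-- Condition on `u k = x`: clock j stays behind with probability exp(-q j * x / q k). Together with
the density exp(-x), and since the other speeds sum to 1 - q k, the total exponent is -x / q k. -/
lemma lintegral_race {q : Fin (n + 1) → ℝ} (hq : ∀ j, 0 ≤ q j) (hsum : ∑ j, q j = 1)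
    {k : Fin (n + 1)} (hk : 0 < q k) {h : ℝ → ℝ≥0∞} (hh : Measurable h) :
    ∫⁻ u in race q k, h (u k) ∂(clocks n) =
      ∫⁻ x in Set.Ioi 0, ENNReal.ofReal (Real.exp (-((q k)⁻¹ * x))) * h x := by
  let R : Set (ℝ × (Fin n → ℝ)) := {z | ∀ j, q (k.succAbove j) * z.1 < q k * z.2 j}
  have hR : MeasurableSet R := by
    have : R = ⋂ j, {z | q (k.succAbove j) * z.1 < q k * z.2 j} := by ext z; simp [R]
    rw [this]
    exact MeasurableSet.iInter fun j => measurableSet_lt (by fun_prop) (by fun_prop)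
  have hmp := measurePreserving_piFinSuccAbove (fun _ : Fin (n + 1) => expLaw) k
  have hF : Measurable (R.indicator fun z : ℝ × (Fin n → ℝ) => h z.1) :=
    (hh.comp measurable_fst).indicator hR
  rw [← lintegral_indicator (measurableSet_race q k)]
  have h1 : (race q k).indicator (fun u => h (u k)) =
      fun u => R.indicator (fun z : ℝ × (Fin n → ℝ) => h z.1)
        (MeasurableEquiv.piFinSuccAbove (fun _ => ℝ) k u) := by
    funext u
    have : u ∈ race q k ↔ MeasurableEquiv.piFinSuccAbove (fun _ => ℝ) k u ∈ R := by
      constructor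
      · intro hu j
        exact hu _ (Fin.succAbove_ne k j)
      · intro hu j hj
        obtain ⟨i, rfl⟩ := Fin.exists_succAbove_eq hj
        exact hu i
    by_cases hu : u ∈ race q k
    · rw [Set.indicator_of_mem hu, Set.indicator_of_mem (this.1 hu)]; rfl
    · rw [Set.indicator_of_notMem hu, Set.indicator_of_notMem (fun h => hu (this.2 h))]
  rw [h1, clocks, hmp.lintegral_comp hF, lintegral_prod _ hF.aemeasurable, lintegral_expLaw _
    hF.lintegral_prod_right']
  refine setLIntegral_congr_fun measurableSet_Ioi fun x hx => ?_
  have hx : 0 < x := hx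
  have h2 : ∀ v : Fin n → ℝ, R.indicator (fun z : ℝ × (Fin n → ℝ) => h z.1) (x, v) =
      (Set.univ.pi fun j => Set.Ioi (q (k.succAbove j) * x / q k)).indicator (fun _ => h x) v := by
    intro v
    have : (x, v) ∈ R ↔ v ∈ Set.univ.pi fun j => Set.Ioi (q (k.succAbove j) * x / q k) := by
      simp [R, div_lt_iff₀' hk]
    by_cases hu : (x, v) ∈ R
    · rw [Set.indicator_of_mem hu, Set.indicator_of_mem (this.1 hu)]
    · rw [Set.indicator_of_notMem hu, Set.indicator_of_notMem (fun h => hu (this.2 h))]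
  simp only [h2]
  rw [lintegral_indicator_const (MeasurableSet.univ_pi fun _ => measurableSet_Ioi), Measure.pi_pi]
  have h3 : ∀ j, expLaw (Set.Ioi (q (k.succAbove j) * x / q k)) =
      ENNReal.ofReal (Real.exp (-(q (k.succAbove j) * x / q k))) := fun j =>
    expLaw_Ioi (by have := hq (k.succAbove j); positivity)
  simp only [h3]
  rw [← ENNReal.ofReal_prod_of_nonneg (fun _ _ => (Real.exp_pos _).le), ← Real.exp_sum,
    mul_left_comm, ← ENNReal.ofReal_mul (Real.exp_pos _).le, ← Real.exp_add, mul_comm]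
  congr 3
  rw [Fin.sum_univ_succAbove _ k] at hsum
  rw [Finset.sum_neg_distrib, ← Finset.sum_div, ← Finset.sum_mul,
    show ∑ i, q (k.succAbove i) = 1 - q k by linarith]
  field_simp
  ring

lemma clocks_race {q : Fin (n + 1) → ℝ} (hq : ∀ j, 0 ≤ q j) (hsum : ∑ j, q j = 1)
    {k : Fin (n + 1)} (hk : 0 < q k) : clocks n (race q k) = ENNReal.ofReal (q k) := by
  have h := lintegral_race hq hsum hk (h := fun _ => 1) measurable_const
  simp only [lintegral_const, one_mul, mul_one, MeasurableSet.univ, Measure.restrict_apply,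
    Set.univ_inter] at h
  rw [h]
  refine lintegral_Ioi_eq (fun _ _ => (Real.exp_pos _).le) ?_ hk.ne'
  have h1 := Real.integral_rpow_mul_exp_neg_mul_Ioi one_pos (inv_pos.2 hk)
  simpa using h1

lemma lintegral_race_id {q : Fin (n + 1) → ℝ} (hq : ∀ j, 0 ≤ q j) (hsum : ∑ j, q j = 1)
    {k : Fin (n + 1)} (hk : 0 < q k) :
    ∫⁻ u in race q k, ENNReal.ofReal |u k| ∂(clocks n) = ENNReal.ofReal (q k ^ 2) := by
  rw [lintegral_race hq hsum hk (h := fun x => ENNReal.ofReal |x|) (by fun_prop)]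
  simp_rw [← ENNReal.ofReal_mul (Real.exp_pos _).le]
  refine lintegral_Ioi_eq (fun _ _ => by positivity) ?_ (by positivity)
  have h1 := Real.integral_rpow_mul_exp_neg_mul_Ioi two_pos (inv_pos.2 hk)
  simp only [show (2 : ℝ) - 1 = 1 by norm_num, Real.rpow_one, one_div, inv_inv, Real.Gamma_two,
    Real.rpow_two, mul_one] at h1
  rw [← h1]
  refine setIntegral_congr_fun measurableSet_Ioi fun x hx => ?_
  simp only [abs_of_pos (Set.mem_Ioi.1 hx), mul_comm]

lemma integrable_abs_clock (k : Fin (n + 1)) : Integrable (fun u => |u k|) (clocks n) := by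
  have hmp : MeasurePreserving (Function.eval k) (clocks n) expLaw :=
    measurePreserving_eval (fun _ : Fin (n + 1) => expLaw) k
  have h : Integrable (fun x : ℝ => |x|) expLaw := by
    refine ⟨by fun_prop, ?_⟩
    have h1 := Real.integral_rpow_mul_exp_neg_mul_Ioi two_pos one_pos
    simp only [show (2 : ℝ) - 1 = 1 by norm_num, Real.rpow_one, one_div, Real.Gamma_two,
      Real.rpow_two, mul_one, one_mul, inv_one, one_pow] at h1
    have h2 : ∫⁻ x, ENNReal.ofReal |x| ∂expLaw = ENNReal.ofReal 1 := by
      rw [lintegral_expLaw _ (by fun_prop)]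
      simp_rw [← ENNReal.ofReal_mul (Real.exp_pos _).le]
      refine lintegral_Ioi_eq (fun _ _ => by positivity) ?_ one_ne_zero
      rw [← h1]
      refine setIntegral_congr_fun measurableSet_Ioi fun x hx => ?_
      simp only [abs_of_pos (Set.mem_Ioi.1 hx), mul_comm]
    rw [hasFiniteIntegral_iff_norm]
    simp [h2]
  exact (hmp.integrable_comp (by fun_prop)).2 h

/-- The weight that the decoder gives to a clock ringing at time `x`. -/
def raceWeight (t c p x : ℝ) : ℝ := t * (c * p) ^ t * (|x| + c * p) ^ (-(1 + t))

lemma raceWeight_pos {t c p : ℝ} (ht : 0 < t) (hc : 0 < c) (hp : 0 < p) (x : ℝ) :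
    0 < raceWeight t c p x := by
  unfold raceWeight; positivity

lemma measurable_raceWeight (t c p : ℝ) : Measurable (raceWeight t c p) := by
  unfold raceWeight; fun_prop

/-- On the positive half-line the weight is a Lebesgue probability density, with primitive -(cp)^t
(x + cp)^(-t), and the exponential density is at most 1. -/
lemma lintegral_raceWeight_le {t c p : ℝ} (ht : 0 < t) (hc : 0 < c) (hp : 0 < p)
    (k : Fin (n + 1)) :
    ∫⁻ u, ENNReal.ofReal (raceWeight t c p (u k)) ∂(clocks n) ≤ 1 := by
  have hmp : MeasurePreserving (Function.eval k) (clocks n) expLaw :=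
    measurePreserving_eval (fun _ : Fin (n + 1) => expLaw) k
  have hm : Measurable fun x => ENNReal.ofReal (raceWeight t c p x) :=
    (measurable_raceWeight t c p).ennreal_ofReal
  have h0 := hmp.lintegral_comp hm
  simp only [Function.eval] at h0
  rw [h0, lintegral_expLaw _ hm]
  have hd : 0 < c * p := mul_pos hc hp
  have hder : ∀ x ∈ Set.Ici (0 : ℝ),
      HasDerivAt (fun x => -((c * p) ^ t * (x + c * p) ^ (-t))) (raceWeight t c p x) x := by
    intro x hx
    have hx : 0 ≤ x := hx
    have h1 : HasDerivAt (fun x => x + c * p) 1 x := (hasDerivAt_id x).add_const _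
    have h2 := ((h1.rpow_const (p := -t) (Or.inl (by positivity))).const_mul ((c * p) ^ t)).neg
    refine h2.congr_deriv ?_
    unfold raceWeight
    rw [abs_of_nonneg hx, show -t - 1 = -(1 + t) by ring]
    ring
  have hlim : Filter.Tendsto (fun x => -((c * p) ^ t * (x + c * p) ^ (-t))) Filter.atTop
      (nhds 0) := by
    have h1 := (tendsto_rpow_neg_atTop ht).comp
      (Filter.tendsto_atTop_add_const_right Filter.atTop (c * p) Filter.tendsto_id)
    simpa using (h1.const_mul ((c * p) ^ t)).neg
  have hpos : ∀ x ∈ Set.Ioi (0 : ℝ), 0 ≤ raceWeight t c p x := fun x _ =>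
    (raceWeight_pos ht hc hp x).le
  have hint := integral_Ioi_of_hasDerivAt_of_nonneg' hder hpos hlim
  have h1 : (c * p) ^ t * (c * p) ^ (-t) = 1 := by
    rw [← Real.rpow_add hd]; simp
  rw [zero_add, h1, zero_sub, neg_neg] at hint
  calc _ ≤ ∫⁻ x in Set.Ioi 0, ENNReal.ofReal (raceWeight t c p x) := by
        refine setLIntegral_mono' measurableSet_Ioi fun x hx => ?_
        refine mul_le_of_le_one_left zero_le ?_
        rw [← ENNReal.ofReal_one]
        exact ENNReal.ofReal_le_ofReal (Real.exp_le_one_iff.2 (neg_nonpos.2 (le_of_lt hx)))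
    _ = 1 := by rw [lintegral_Ioi_eq hpos hint one_ne_zero, ENNReal.ofReal_one]

lemma integrable_raceWeight {t c p : ℝ} (ht : 0 < t) (hc : 0 < c) (hp : 0 < p) (k : Fin (n + 1)) :
    Integrable (fun u => raceWeight t c p (u k)) (clocks n) := by
  refine ⟨((measurable_raceWeight t c p).comp (measurable_pi_apply k)).aestronglyMeasurable, ?_⟩
  rw [hasFiniteIntegral_iff_norm]
  simp only [Real.norm_eq_abs, abs_of_pos (raceWeight_pos ht hc hp _)]
  exact (lintegral_raceWeight_le ht hc hp k).trans_lt ENNReal.one_lt_top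

lemma integral_raceWeight_le {t c p : ℝ} (ht : 0 < t) (hc : 0 < c) (hp : 0 < p) (k : Fin (n + 1)) :
    ∫ u, raceWeight t c p (u k) ∂(clocks n) ≤ 1 := by
  rw [integral_eq_lintegral_of_nonneg_ae (ae_of_all _ fun u => (raceWeight_pos ht hc hp _).le)
    (integrable_raceWeight ht hc hp k).1]
  exact ENNReal.toReal_le_of_le_ofReal zero_le_one
    (by simpa using lintegral_raceWeight_le ht hc hp k)

/-- A tangent bound for the logarithm of the weight. -/
lemma exp_le_raceWeight {t c p b : ℝ} (ht : 0 < t) (hc : 0 < c) (hp : 0 < p) (hb : 0 < b) (x : ℝ) :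
    Real.exp (Real.log (t * (c * p) ^ t) - (1 + t) * (Real.log b + (|x| + c * p) / b - 1)) ≤
      raceWeight t c p x := by
  have hd : 0 < c * p := mul_pos hc hp
  have hx : 0 < |x| + c * p := by positivity
  rw [← Real.le_log_iff_exp_le (raceWeight_pos ht hc hp x), raceWeight,
    Real.log_mul (show t * (c * p) ^ t ≠ 0 by positivity) (by positivity), Real.log_rpow hx]
  have h1 := Real.log_le_sub_one_of_pos (show 0 < (|x| + c * p) / b by positivity)
  rw [Real.log_div hx.ne' hb.ne'] at h1
  nlinarith

open scoped Classical in
/-- The clock that rings first (`0` if there is a tie). -/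
def winner (q : Fin (n + 1) → ℝ) (u : Fin (n + 1) → ℝ) : Fin (n + 1) :=
  if h : ∃ k, u ∈ race q k then h.choose else 0

lemma winner_eq {q : Fin (n + 1) → ℝ} {u : Fin (n + 1) → ℝ} {k : Fin (n + 1)}
    (h : u ∈ race q k) : winner q u = k := by
  have h' : ∃ k, u ∈ race q k := ⟨k, h⟩
  rw [winner, dif_pos h']
  exact race_disjoint q h'.choose_spec h

lemma measurable_winner (q : Fin (n + 1) → ℝ) : Measurable (winner q) := by
  refine measurable_to_countable' fun k => ?_
  have : winner q ⁻¹' {k} = race q k ∪ (if k = 0 then (⋃ j, race q j)ᶜ else ∅) := by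
    ext u
    simp only [Set.mem_preimage, Set.mem_singleton_iff, Set.mem_union]
    by_cases h : ∃ j, u ∈ race q j
    · obtain ⟨j, hj⟩ := h
      rw [winner_eq hj]
      constructor
      · rintro rfl; exact Or.inl hj
      · rintro (h | h)
        · exact race_disjoint q hj h
        · split_ifs at h
          · exact absurd (Set.mem_iUnion.2 ⟨j, hj⟩) h
          · exact absurd h (Set.notMem_empty _)
    · rw [winner, dif_neg h]
      have h1 : u ∉ race q k := fun h' => h ⟨k, h'⟩
      by_cases hk : k = 0
      · simp [hk]
        right
        exact fun j hj => h ⟨j, hj⟩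
      · simp [hk, h1, Ne.symm hk]
  rw [this]
  refine (measurableSet_race q k).union ?_
  split_ifs
  · exact (MeasurableSet.iUnion fun j => measurableSet_race q j).compl
  · exact MeasurableSet.empty

/-- Ties need no separate treatment: each clock wins with probability at least `q k`, and both
families sum to 1. -/
lemma clocks_winner {q : Fin (n + 1) → ℝ} (hq : ∀ j, 0 ≤ q j) (hsum : ∑ j, q j = 1)
    (k : Fin (n + 1)) : (clocks n).real (winner q ⁻¹' {k}) = q k := by
  have hle : ∀ j, q j ≤ (clocks n).real (winner q ⁻¹' {j}) := by
    intro j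
    rcases (hq j).eq_or_lt with h0 | h0
    · rw [← h0]; exact measureReal_nonneg
    · have h1 : (clocks n).real (race q j) = q j := by
        rw [measureReal_def, clocks_race hq hsum h0, ENNReal.toReal_ofReal h0.le]
      rw [← h1]
      exact measureReal_mono fun u hu => winner_eq hu
  have htot : ∑ j, (clocks n).real (winner q ⁻¹' {j}) = 1 := by
    have h1 := sum_measureReal_preimage_singleton (μ := clocks n) (f := winner q) Finset.univ
      (fun y _ => measurable_winner q (measurableSet_singleton y))
    rw [h1]; simp
  have h1 : ∀ j ∈ Finset.univ, 0 ≤ (clocks n).real (winner q ⁻¹' {j}) - q j :=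
    fun j _ => sub_nonneg.2 (hle j)
  have h2 := (Finset.sum_eq_zero_iff_of_nonneg h1).1 (by rw [Finset.sum_sub_distrib, htot, hsum,
    sub_self]) k (Finset.mem_univ k)
  linarith

/-- Given that clock k wins, its reading is exponential with mean `q k`; the other factor `q k` is
the probability of winning. -/
lemma setIntegral_winner {q : Fin (n + 1) → ℝ} (hq : ∀ j, 0 ≤ q j) (hsum : ∑ j, q j = 1)
    (k : Fin (n + 1)) : ∫ u in winner q ⁻¹' {k}, |u k| ∂(clocks n) = q k ^ 2 := by
  have hw := clocks_winner hq hsum k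
  rcases (hq k).eq_or_lt with h0 | h0
  · rw [← h0, measureReal_def, ENNReal.toReal_eq_zero_iff] at hw
    rw [← h0, Measure.restrict_eq_zero.2 (hw.resolve_right (measure_ne_top _ _))]
    simp
  · have hae : race q k =ᵐ[clocks n] winner q ⁻¹' {k} := by
      refine ae_eq_of_subset_of_measure_ge (fun u hu => winner_eq hu) ?_
        (measurableSet_race q k).nullMeasurableSet (measure_ne_top _ _)
      rw [clocks_race hq hsum h0, ← hw, ofReal_measureReal]
    rw [← setIntegral_congr_set hae, integral_eq_lintegral_of_nonneg_ae
      (ae_of_all _ fun u => abs_nonneg _) (integrable_abs_clock k).1.restrict, lintegral_race_id hq hsum h0,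
      ENNReal.toReal_ofReal (by positivity)]

end ExponentialRace

/-! ### One random function that simulates a finite family of laws. -/

section FunctionalRepresentation

variable {n : ℕ}

/-- Jensen's inequality for the logarithm of an average. -/
lemma setIntegral_le_mul_log {Ω : Type*} [MeasurableSpace Ω] {μ : Measure Ω} [IsFiniteMeasure μ]
    {s : Set Ω} {f ℓ : Ω → ℝ} (hf : Integrable f μ) (hℓ : Integrable ℓ μ)
    (h : ∀ x, Real.exp (ℓ x) ≤ f x) (hs : 0 < μ.real s) :
    ∫ x in s, ℓ x ∂μ ≤ μ.real s * Real.log ((μ.real s)⁻¹ * ∫ x in s, f x ∂μ) := by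
  set m := μ.real s with hm
  set a := m⁻¹ * ∫ x in s, ℓ x ∂μ with ha
  have hma : ∫ x in s, ℓ x ∂μ = m * a := by rw [ha, mul_inv_cancel_left₀ hs.ne']
  have h1 : m * Real.exp a ≤ ∫ x in s, f x ∂μ := by
    -- The integrand is the tangent to the exponential at the average `a`, evaluated at `ℓ x`.
    -- Working with `ℓ` avoids any integrability question for log f.
    have h2 : ∫ x in s, Real.exp a * (ℓ x + (1 - a)) ∂μ = m * Real.exp a := by
      rw [integral_const_mul, integral_add hℓ.restrict (integrable_const _), hma]
      simp only [integral_const, MeasurableSet.univ, measureReal_restrict_apply, Set.univ_inter,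
        ← hm, smul_eq_mul]
      ring
    rw [← h2]
    refine integral_mono (((hℓ.restrict).add (integrable_const _)).const_mul _) hf.restrict ?_
    intro x
    refine le_trans ?_ (h x)
    have h3 := Real.add_one_le_exp (ℓ x - a)
    have h4 : Real.exp (ℓ x) = Real.exp a * Real.exp (ℓ x - a) := by
      rw [← Real.exp_add]; congr 1; ring
    rw [h4]
    refine mul_le_mul_of_nonneg_left ?_ (Real.exp_pos _).le
    linarith
  have h5 : a ≤ Real.log (m⁻¹ * ∫ x in s, f x ∂μ) := by
    have h6 : Real.exp a ≤ m⁻¹ * ∫ x in s, f x ∂μ := by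
      rw [le_inv_mul_iff₀ hs]; exact h1
    rw [Real.le_log_iff_exp_le ((Real.exp_pos _).trans_le h6)]
    exact h6
  rw [hma]
  exact mul_le_mul_of_nonneg_left h5 hs.le

/-- A single random function `y` that simulates all the laws `q i` at once, together with a decoder
weight `g`. -/
theorem exists_functionalRepresentation {ι : Type*} [Fintype ι] [DecidableEq ι] {t c : ℝ}
    (ht : 0 < t) (hc : 0 < c) {p : Fin (n + 1) → ℝ} (hp : ∀ k, 0 < p k)
    {q : ι → Fin (n + 1) → ℝ} (hq : ∀ i k, 0 ≤ q i k) (hsum : ∀ i, ∑ k, q i k = 1) :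
    ∃ (ν : (ι → Fin (n + 1)) → ℝ) (g : (ι → Fin (n + 1)) → Fin (n + 1) → ℝ),
      (∀ y, 0 ≤ ν y) ∧ ∑ y, ν y = 1 ∧ (∀ i k, ∑ y with y i = k, ν y = q i k) ∧
      (∀ y k, 0 < g y k) ∧ (∀ k, ∑ y, ν y * g y k ≤ 1) ∧
      ∀ i, ∑ k, q i k * (Real.log (t * (c * p k) ^ t) - (1 + t) * Real.log (q i k + c * p k)) ≤
        ∑ y, ν y * Real.log (g y (y i)) := by
  -- The same clocks serve every `i`; `y` is the list of winners and the cells `C y` partition the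
  -- clock space.
  let f : (Fin (n + 1) → ℝ) → ι → Fin (n + 1) := fun u i => winner (q i) u
  have hf : Measurable f := measurable_pi_lambda _ fun i => measurable_winner (q i)
  let C : (ι → Fin (n + 1)) → Set (Fin (n + 1) → ℝ) := fun y => f ⁻¹' {y}
  have hC : ∀ y, MeasurableSet (C y) := fun y => hf (measurableSet_singleton y)
  have hdisj : Pairwise (Function.onFun Disjoint C) := fun y z h =>
    Disjoint.preimage _ (Set.disjoint_singleton.2 h)
  let ν : (ι → Fin (n + 1)) → ℝ := fun y => (clocks n).real (C y)
  let γ : Fin (n + 1) → (Fin (n + 1) → ℝ) → ℝ := fun k u => raceWeight t c (p k) (u k)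
  have hγ : ∀ k, Integrable (γ k) (clocks n) := fun k => integrable_raceWeight ht hc (hp k) k
  have hγ0 : ∀ k u, 0 < γ k u := fun k u => raceWeight_pos ht hc (hp k) _
  -- The decoder sees only the cell, so it uses the mean weight over the cell. The value 1 on null
  -- cells just keeps `g` positive.
  let g : (ι → Fin (n + 1)) → Fin (n + 1) → ℝ := fun y k =>
    if ν y = 0 then 1 else (ν y)⁻¹ * ∫ u in C y, γ k u ∂(clocks n)
  have hcell : ∀ i k, winner (q i) ⁻¹' {k} = ⋃ y ∈ ({y | y i = k} : Finset (ι → Fin (n + 1))),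
      C y := by
    intro i k
    ext u
    simp [C, f]
  have hpart : ∀ (F : (Fin (n + 1) → ℝ) → ℝ), Integrable F (clocks n) → ∀ i k,
      ∑ y with y i = k, ∫ u in C y, F u ∂(clocks n) =
        ∫ u in winner (q i) ⁻¹' {k}, F u ∂(clocks n) := by
    intro F hF i k
    rw [hcell, integral_biUnion_finset _ (fun y _ => hC y) (fun y _ z _ h => hdisj h)
      (fun y _ => hF.integrableOn)]
  have hmarg : ∀ i k, ∑ y with y i = k, ν y = q i k := by
    intro i k
    have h := hpart (fun _ => 1) (integrable_const _) i k
    simp only [integral_const, MeasurableSet.univ, measureReal_restrict_apply, Set.univ_inter,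
      smul_eq_mul, mul_one] at h
    rw [clocks_winner (hq i) (hsum i)] at h
    exact h
  have hall : ⋃ y, C y = Set.univ := by ext u; simp [C]
  have hgpos : ∀ y k, 0 < g y k := by
    intro y k
    by_cases h : ν y = 0
    · simp [g, h]
    · have h' : 0 < ν y := measureReal_nonneg.lt_of_ne (Ne.symm h)
      have : 0 < ∫ u in C y, γ k u ∂(clocks n) := by
        rw [setIntegral_pos_iff_support_of_nonneg_ae (ae_of_all _ fun u => (hγ0 k u).le)
          (hγ k).integrableOn, Function.support_eq_univ (fun u => (hγ0 k u).ne'), Set.univ_inter]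
        exact (ENNReal.toReal_pos_iff.1 h').1
      simp only [g, h, if_false]
      positivity
  refine ⟨ν, g, fun y => measureReal_nonneg, ?_, hmarg, hgpos, fun k => ?_, fun i => ?_⟩
  · have h1 := sum_measureReal_preimage_singleton (μ := clocks n) (f := f) Finset.univ
      (fun y _ => hC y)
    change ∑ y, (clocks n).real (f ⁻¹' {y}) = 1
    rw [h1]; simp
  · calc ∑ y, ν y * g y k ≤ ∑ y, ∫ u in C y, γ k u ∂(clocks n) := by
          refine Finset.sum_le_sum fun y _ => ?_
          by_cases h : ν y = 0
          · rw [h, zero_mul]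
            exact integral_nonneg fun u => (hγ0 k u).le
          · simp only [g, h, if_false]
            rw [mul_inv_cancel_left₀ h]
      _ = ∫ u, γ k u ∂(clocks n) := by
          rw [← integral_iUnion_fintype hC hdisj (fun y => (hγ k).integrableOn), hall,
            setIntegral_univ]
      _ ≤ 1 := integral_raceWeight_le ht hc (hp k) k
  -- The tangent point is the conditional mean of |u k| + c p k given that k wins, so the linear
  -- correction in `ℓ` integrates to zero.
  · let b : Fin (n + 1) → ℝ := fun k => q i k + c * p k
    have hb : ∀ k, 0 < b k := fun k => by
      have := hp k; have := hq i k; positivity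
    let ℓ : Fin (n + 1) → (Fin (n + 1) → ℝ) → ℝ := fun k u =>
      Real.log (t * (c * p k) ^ t) -
        (1 + t) * (Real.log (b k) + (|u k| + c * p k) / b k - 1)
    have hℓ : ∀ k, Integrable (ℓ k) (clocks n) := by
      intro k
      have := integrable_abs_clock k
      refine (integrable_const _).sub (Integrable.const_mul ?_ _)
      exact ((integrable_const _).add ((this.add (integrable_const _)).div_const _)).sub
        (integrable_const _)
    have hjensen : ∀ y k, ∫ u in C y, ℓ k u ∂(clocks n) ≤ ν y * Real.log (g y k) := by
      intro y k
      by_cases h : ν y = 0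
      · have h0 : clocks n (C y) = 0 := by
          have : (clocks n).real (C y) = 0 := h
          rwa [measureReal_def, ENNReal.toReal_eq_zero_iff, or_iff_left (measure_ne_top _ _)] at this
        rw [h, Measure.restrict_eq_zero.2 h0]
        simp
      · have h' : 0 < ν y := measureReal_nonneg.lt_of_ne (Ne.symm h)
        simp only [g, h, if_false]
        exact setIntegral_le_mul_log (hγ k) (hℓ k)
          (fun u => exp_le_raceWeight ht hc (hp k) (hb k) _) h'
    calc _ = ∑ k, ∫ u in winner (q i) ⁻¹' {k}, ℓ k u ∂(clocks n) := by
          refine Finset.sum_congr rfl fun k _ => ?_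
          have h1 := integrable_abs_clock k
          have hw := clocks_winner (hq i) (hsum i) k
          have h3 : ∀ u : Fin (n + 1) → ℝ, ℓ k u = Real.log (t * (c * p k) ^ t) -
              (1 + t) * (Real.log (b k) + c * p k / b k - 1) + -((1 + t) / b k) * |u k| := by
            intro u; simp only [ℓ]; ring
          simp only [h3]
          rw [integral_add (integrable_const _) (h1.restrict.const_mul _), integral_const_mul,
            setIntegral_winner (hq i) (hsum i)]
          simp only [integral_const, MeasurableSet.univ, measureReal_restrict_apply, Set.univ_inter,
            hw, smul_eq_mul]
          have h2 : (q i k ^ 2 + q i k * (c * p k)) / b k = q i k := by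
            rw [div_eq_iff (hb k).ne']; ring
          linear_combination (1 + t) * h2
      _ = ∑ k, ∑ y with y i = k, ∫ u in C y, ℓ k u ∂(clocks n) :=
          Finset.sum_congr rfl fun k _ => (hpart _ (hℓ k) i k).symm
      _ = ∑ y, ∫ u in C y, ℓ (y i) u ∂(clocks n) := by
          rw [← Finset.sum_fiberwise Finset.univ (fun y : ι → Fin (n + 1) => y i)]
          refine Finset.sum_congr rfl fun k _ => Finset.sum_congr rfl fun y hy => ?_
          rw [(Finset.mem_filter.1 hy).2]
      _ ≤ _ := Finset.sum_le_sum fun y _ => hjensen y (y i)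

end FunctionalRepresentation

/-! ### Entropy estimate for the decoder, numerical constants, and conditional laws. -/

section Coding

variable {n : ℕ}

/-- The exponent of the decoder compared with entropy and divergence. -/
lemma sum_mul_log_ge {κ : Type*} [Fintype κ] {t c : ℝ} (ht : 0 < t) (hc : 0 < c) {p p' q : κ → ℝ}
    (hp : ∀ k, 0 ≤ p k) (hpsum : ∑ k, p k = 1) (hq : ∀ k, 0 ≤ q k) (hqsum : ∑ k, q k = 1)
    (hqp : ∀ k, q k ≠ 0 → 0 < p k ∧ p' k = p k) :
    Real.log t - Real.log (1 + c) - t * Real.log ((1 + c) / c) + ∑ k, q k * Real.log (1 / q k)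
        - t * ∑ k, klTerm (q k) (p k) ≤
      ∑ k, q k * (Real.log (t * (c * p' k) ^ t) - (1 + t) * Real.log (q k + c * p' k)) := by
  have hkl : ∑ k, klTerm (q k) (p k) = ∑ k, q k * Real.log (q k / p k) := by
    simp only [klTerm, Finset.sum_add_distrib, Finset.sum_sub_distrib, hpsum, hqsum]
    ring
  -- Tangent bound of log(q + cp) at q(1 + c). The error term (q + cp)/(1 + c) - q sums to zero
  -- because p and q both have total mass one.
  have hterm : ∀ k, q k * (Real.log t - Real.log (1 + c) - t * Real.log ((1 + c) / c))
      + q k * Real.log (1 / q k) - t * (q k * Real.log (q k / p k))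
      - (1 + t) * ((q k + c * p k) / (1 + c) - q k) ≤
      q k * (Real.log (t * (c * p' k) ^ t) - (1 + t) * Real.log (q k + c * p' k)) := by
    intro k
    rcases (hq k).eq_or_lt with h0 | h0
    · rw [← h0]
      have := hp k
      have : 0 ≤ (1 + t) * ((0 + c * p k) / (1 + c) - 0) := by
        rw [zero_add, sub_zero]; positivity
      simp only [zero_mul, mul_zero]
      linarith
    obtain ⟨hpk, hp'⟩ := hqp k h0.ne'
    rw [hp']
    have hb : 0 < q k + c * p k := by positivity
    have h1 := Real.log_le_sub_one_of_pos (show 0 < (q k + c * p k) / (q k * (1 + c)) by positivity)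
    rw [Real.log_div hb.ne' (by positivity), Real.log_mul h0.ne' (by positivity)] at h1
    have h2 := mul_le_mul_of_nonneg_left h1 h0.le
    rw [show q k * ((q k + c * p k) / (q k * (1 + c)) - 1) = (q k + c * p k) / (1 + c) - q k by
      field_simp] at h2
    rw [Real.log_mul ht.ne' (by positivity), Real.log_rpow (by positivity),
      Real.log_mul hc.ne' hpk.ne', Real.log_div h0.ne' hpk.ne', Real.log_div (by positivity) hc.ne',
      one_div, Real.log_inv]
    have h3 := mul_le_mul_of_nonneg_left h2 (show 0 ≤ 1 + t by positivity)
    nlinarith [h3]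
  have hsum := Finset.sum_le_sum fun k (_ : k ∈ Finset.univ) => hterm k
  refine le_trans (le_of_eq ?_) hsum
  rw [Finset.sum_sub_distrib, Finset.sum_sub_distrib, Finset.sum_add_distrib, ← Finset.sum_mul,
    ← Finset.mul_sum, ← Finset.mul_sum, Finset.sum_sub_distrib, ← Finset.sum_div,
    Finset.sum_add_distrib, ← Finset.mul_sum, hkl, hpsum, hqsum]
  field_simp
  ring

/-- The budget of constants in nats. The right side collects log t for t = 1/(J + log 45), the cost
log(1 + c) with c = 1/44, the term 1 = t(J + log 45), and the cost of mixing the decoder with the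
constant 1/100. The number 5.51 covers log₂ 45, and 1.06 covers the rest. -/
lemma log_const_bound {J ρ : ℝ} (hJ : 0 ≤ J) (hρ' : ρ ≤ 1 / 400) :
    -(Real.log (J / Real.log 2 + 5.51) + 1.06 * Real.log 2) ≤
      Real.log (99 / 100) + Real.log (J + Real.log 45)⁻¹ - Real.log (1 + 1 / 44) - 1
        + ρ * Real.log (1 / 100) := by
  have l2 := Real.log_two_gt_d9
  have l2' := Real.log_two_lt_d9
  have hl : 0 < Real.log 2 := by linarith
  have h45 : Real.log 45 ≤ 5.5 * Real.log 2 := by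
    -- 45² = 2025 ≤ 2048 = 2¹¹.
    have h : Real.log ((45 : ℝ) ^ 2) ≤ Real.log ((2 : ℝ) ^ 11) :=
      Real.log_le_log (by norm_num) (by norm_num)
    rw [Real.log_pow, Real.log_pow] at h
    push_cast at h
    linarith
  have h45' : 0 < Real.log 45 := Real.log_pos (by norm_num)
  have h1 : Real.log (J + Real.log 45) ≤ Real.log (Real.log 2) +
      Real.log (J / Real.log 2 + 5.51) := by
    rw [← Real.log_mul hl.ne' (by positivity)]
    refine Real.log_le_log (by positivity) ?_
    rw [mul_add, mul_div_cancel₀ _ hl.ne']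
    linarith
  have h2 : Real.log (Real.log 2) ≤ 2 * (0.833 - 1) := by
    -- Since log 2 ≤ 0.833², the bound log x ≤ x - 1 is applied to the square root, where it is
    -- sharper.
    have h3 : Real.log (Real.log 2) ≤ Real.log ((0.833 : ℝ) ^ 2) :=
      Real.log_le_log hl (by norm_num; linarith)
    rw [Real.log_pow] at h3
    have h4 := Real.log_le_sub_one_of_pos (show (0 : ℝ) < 0.833 by norm_num)
    push_cast at h3
    linarith
  have h3 := Real.log_le_sub_one_of_pos (show (0 : ℝ) < 1 + 1 / 44 by norm_num)
  have h4 : -Real.log (99 / 100) ≤ 1 / 99 := by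
    rw [← Real.log_inv]
    refine (Real.log_le_sub_one_of_pos (by norm_num)).trans (by norm_num)
  have h5 : -Real.log (1 / 100) ≤ 7 * Real.log 2 := by
    rw [← Real.log_inv, show (7 : ℝ) = ((7 : ℕ) : ℝ) by norm_num, ← Real.log_pow]
    exact Real.log_le_log (by norm_num) (by norm_num)
  have h6 : ρ * -Real.log (1 / 100) ≤ 1 / 400 * (7 * Real.log 2) :=
    mul_le_mul hρ' h5 (by rw [neg_nonneg]; exact Real.log_nonpos (by norm_num) (by norm_num))
      (by norm_num)
  rw [Real.log_inv]
  nlinarith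

/-- The law on a finite type with the given real weights. -/
def realPMF {κ : Type*} [Fintype κ] (f : κ → ℝ) (hf : ∀ k, 0 ≤ f k) (hsum : ∑ k, f k = 1) : PMF κ :=
  PMF.ofFintype (fun k => ENNReal.ofReal (f k))
    (by rw [← ENNReal.ofReal_sum_of_nonneg fun k _ => hf k, hsum, ENNReal.ofReal_one])

lemma toReal_realPMF {κ : Type*} [Fintype κ] (f : κ → ℝ) (hf : ∀ k, 0 ≤ f k)
    (hsum : ∑ k, f k = 1) (k : κ) : (realPMF f hf hsum k).toReal = f k :=
  ENNReal.toReal_ofReal (hf k)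

lemma joint_prob_pair_comp {Ω : Type u} {γ : Type v} {𝒴 : Type z} (P : PMF Ω) (C : Ω → γ)
    (w : γ → PMF 𝒴) (y : 𝒴) (c : γ) :
    prob (joint P fun ω => w (C ω)) (fun ω => (ω.2, C ω.1)) (y, c) =
      prob P C c * (w c y).toReal := by
  rw [prob, joint_map_pair_comp, ENNReal.toReal_mul]; rfl

lemma prob_pair_swap {Ω : Type u} {α : Type v} {β : Type w} (P : PMF Ω) (A : Ω → α) (B : Ω → β)
    (a : α) (b : β) : prob P (fun ω => (A ω, B ω)) (a, b) = prob P (fun ω => (B ω, A ω)) (b, a) :=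
  prob_comp_injective P (fun ω => (B ω, A ω)) (f := Prod.swap) Prod.swap_injective (b, a)

variable {Ω : Type u} {α : Type v}

/-- The conditional law of `K` given `A = a` (the law of `K` if `A = a` has probability zero). -/
def condProb (P : PMF Ω) (A : Ω → α) (K : Ω → Fin (n + 1)) (a : α) (k : Fin (n + 1)) : ℝ :=
  if prob P A a = 0 then prob P K k else prob P (fun ω => (A ω, K ω)) (a, k) / prob P A a

variable (P : PMF Ω) (A : Ω → α) (K : Ω → Fin (n + 1))

lemma condProb_nonneg (a : α) (k : Fin (n + 1)) : 0 ≤ condProb P A K a k := by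
  unfold condProb
  split_ifs
  · exact prob_nonneg _ _ _
  · exact div_nonneg (prob_nonneg _ _ _) (prob_nonneg _ _ _)

lemma sum_prob (K : Ω → Fin (n + 1)) : ∑ k, prob P K k = 1 :=
  (hasSum_fintype _).unique (hasSum_prob P K)

lemma sum_condProb (a : α) : ∑ k, condProb P A K a k = 1 := by
  unfold condProb
  split_ifs with h
  · exact sum_prob P K
  · rw [← Finset.sum_div, (hasSum_fintype _).unique (hasSum_prob_snd P A K a), div_self h]

lemma prob_mul_condProb (a : α) (k : Fin (n + 1)) :
    prob P A a * condProb P A K a k = prob P (fun ω => (A ω, K ω)) (a, k) := by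
  unfold condProb
  split_ifs with h
  · rw [h, zero_mul]
    exact (le_antisymm (h ▸ prob_pair_le_left P A K a k) (prob_nonneg _ _ _)).symm
  · rw [mul_div_cancel₀ _ h]

lemma prob_pos_of_condProb_ne_zero {a : α} {k : Fin (n + 1)} (h : condProb P A K a k ≠ 0) :
    0 < prob P K k := by
  by_contra h'
  have h0 : prob P K k = 0 := le_antisymm (not_lt.1 h') (prob_nonneg _ _ _)
  have h1 : prob P (fun ω => (A ω, K ω)) (a, k) = 0 :=
    le_antisymm (h0 ▸ prob_pair_le_right P A K a k) (prob_nonneg _ _ _)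
  apply h
  unfold condProb
  split_ifs
  · exact h0
  · rw [h1, zero_div]

lemma entTerm_eq_condProb (a : α) (k : Fin (n + 1)) :
    entTerm P K A (k, a) =
      prob P A a * (condProb P A K a k * Real.log (1 / condProb P A K a k)) := by
  unfold entTerm
  simp only
  rw [prob_pair_swap, ← prob_mul_condProb]
  by_cases h : prob P A a = 0
  · simp [h]
  by_cases h' : condProb P A K a k = 0
  · simp [h']
  rw [mul_assoc]
  congr 3
  field_simp

/-- The law of the random function `y ~ ν` given `y a = k`. -/
def simWeight [DecidableEq α] {F : Finset α} (ν : (F → Fin (n + 1)) → ℝ) (q : α → Fin (n + 1) → ℝ)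
    (c : α × Fin (n + 1)) (y : F → Fin (n + 1)) : ℝ :=
  if h : c.1 ∈ F ∧ q c.1 c.2 ≠ 0 then (if y ⟨c.1, h.1⟩ = c.2 then ν y / q c.1 c.2 else 0) else ν y

variable [DecidableEq α] {F : Finset α} {ν : (F → Fin (n + 1)) → ℝ} {q : α → Fin (n + 1) → ℝ}

lemma simWeight_nonneg (hν : ∀ y, 0 ≤ ν y) (hq : ∀ a k, 0 ≤ q a k) (c : α × Fin (n + 1))
    (y : F → Fin (n + 1)) : 0 ≤ simWeight ν q c y := by
  unfold simWeight
  split_ifs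
  · exact div_nonneg (hν y) (hq _ _)
  · exact le_rfl
  · exact hν y

lemma sum_simWeight (hsum : ∑ y, ν y = 1)
    (hmarg : ∀ (i : F) k, ∑ y with y i = k, ν y = q i k) (c : α × Fin (n + 1)) :
    ∑ y, simWeight ν q c y = 1 := by
  unfold simWeight
  split_ifs with h
  · rw [← Finset.sum_filter, ← Finset.sum_div, hmarg]
    exact div_self h.2
  · exact hsum

/-- Bayes' rule. If `q i k = 0`, the event y i = k has `ν`-mass zero, so the fallback value of
`simWeight` does no harm. -/
lemma mul_simWeight (hν : ∀ y, 0 ≤ ν y) (hmarg : ∀ (i : F) k, ∑ y with y i = k, ν y = q i k)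
    (i : F) (k : Fin (n + 1)) (y : F → Fin (n + 1)) :
    q i k * simWeight ν q (i, k) y = if y i = k then ν y else 0 := by
  by_cases h : q i k = 0
  · rw [h, zero_mul]
    split_ifs with h'
    · have h1 := hmarg i k
      rw [h, Finset.sum_eq_zero_iff_of_nonneg fun y _ => hν y] at h1
      exact (h1 y (by simp [h'])).symm
    · rfl
  · rw [simWeight, dif_pos ⟨i.2, h⟩]
    split_ifs
    · rw [mul_div_cancel₀ _ h]
    · rw [mul_zero]

end Coding

/-! ### The functional representation for a target with finitely many values. -/

section Simulation

variable {Ω : Type u} {α : Type v} {𝒴 : Type z}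

lemma mutualInfo_map {Ω' : Type*} {β : Type*} {γ : Type*} (p : PMF Ω) (f : Ω → Ω') (A : Ω' → β)
    (B : Ω' → γ) : mutualInfo (p.map f) A B = mutualInfo p (fun ω => A (f ω)) (fun ω => B (f ω)) := by
  unfold mutualInfo
  rw [PMF.map_comp, PMF.map_comp, PMF.map_comp]
  rfl

lemma repInfo_map_equiv {𝒴' : Type*} {γ : Type*} (P : PMF Ω) (W : Ω → PMF 𝒴) (e : 𝒴 ≃ 𝒴')
    (C : Ω → γ) : repInfo P (fun ω => (W ω).map e) C = repInfo P W C := by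
  have h : joint P (fun ω => (W ω).map e) = (joint P W).map (Prod.map id e) := by
    unfold joint
    rw [PMF.map_bind]
    simp only [PMF.map_comp]
    rfl
  rw [repInfo_symm, repInfo_symm, h, mutualInfo_map]
  refine le_antisymm ?_ ?_
  · exact mutualInfo_comp_right_le (joint P W) (fun ω => C ω.1) (fun ω => ω.2) e
  · have := mutualInfo_comp_right_le (joint P W) (fun ω => C ω.1) (fun ω => e ω.2) e.symm
    simpa using this

variable {n : ℕ}

/-- `Y` is the random function conditioned on taking the value `K` at `A`, hence independent of `A`.
A random function can only serve the finite set `F`; for other values of `A` it is drawn from `ν`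
without regard to `K`. The first inequality says that `Y` and `A` determine `K` over `F`; the second
is Gibbs' inequality with the decoder weights. -/
theorem exists_simulation [Countable α] (P : PMF Ω) (A : Ω → α) (K : Ω → Fin (n + 1))
    (F : Finset α) (hF : 399 / 400 ≤ ∑ a ∈ F, prob P A a) :
    ∃ (N : ℕ) (W : Ω → PMF (Fin N)), repInfo P W A = 0 ∧
      ENNReal.ofReal (∑ a ∈ F, ∑ k, entTerm P K A (k, a)) ≤
        repInfo P W (fun ω => (A ω, K ω)) * ENNReal.ofReal (Real.log 2) ∧
      ENNReal.ofReal (∑ a ∈ F, ∑ k, entTerm P K A (k, a)) ≤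
        repInfo P W K * ENNReal.ofReal (Real.log 2) +
        ENNReal.ofReal (Real.log ((mutualInfo P A K).toReal + 5.51) + 1.06 * Real.log 2) := by
  classical
  set q : α → Fin (n + 1) → ℝ := condProb P A K with hqdef
  set J : ℝ := (mutualInfo P A K * ENNReal.ofReal (Real.log 2)).toReal with hJdef
  have hl2 : 0 < Real.log 2 := Real.log_pos one_lt_two
  have hJ0 : 0 ≤ J := ENNReal.toReal_nonneg
  have h45 : 1 < Real.log 45 := by
    rw [Real.lt_log_iff_exp_lt (by norm_num)]
    exact Real.exp_one_lt_d9.trans (by norm_num)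
  -- With c = 1/44 one has (1 + c)/c = 45, and this `t` makes the total cost t(J + log 45) equal to
  -- 1, leaving only log t.
  set t : ℝ := (J + Real.log 45)⁻¹ with htdef
  have ht : 0 < t := by positivity
  have ht1 : t ≤ 1 := inv_le_one_of_one_le₀ (by linarith)
  have hc : (0 : ℝ) < 1 / 44 := by norm_num
  -- The clocks need positive weights; at symbols of probability zero the value is irrelevant, since
  -- `q` vanishes there for every conditional law.
  let p' : Fin (n + 1) → ℝ := fun k => if prob P K k = 0 then 1 else prob P K k
  have hp' : ∀ k, 0 < p' k := by
    intro k
    simp only [p']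
    split_ifs with h
    · exact one_pos
    · exact (prob_nonneg _ _ _).lt_of_ne (Ne.symm h)
  have hq0 : ∀ a k, 0 ≤ q a k := condProb_nonneg P A K
  have hq1 : ∀ a, ∑ k, q a k = 1 := sum_condProb P A K
  obtain ⟨ν, g, hν0, hν1, hmarg, hg0, hg1, hexp⟩ :=
    exists_functionalRepresentation (ι := F) ht hc hp' (q := fun i => q i) (fun i => hq0 i)
      (fun i => hq1 i)
  let s : α × Fin (n + 1) → (F → Fin (n + 1)) → ℝ := simWeight ν q
  have hs0 : ∀ c y, 0 ≤ s c y := simWeight_nonneg hν0 hq0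
  have hs1 : ∀ c, ∑ y, s c y = 1 := sum_simWeight hν1 hmarg
  have hsF : ∀ (i : F) k y, q i k * s (i, k) y = if y i = k then ν y else 0 := mul_simWeight hν0 hmarg
  have hsn : ∀ a, a ∉ F → ∀ k y, s (a, k) y = ν y := by
    intro a ha k y
    simp only [s, simWeight]
    rw [dif_neg (fun h => ha h.1)]
  let w : α × Fin (n + 1) → PMF (F → Fin (n + 1)) := fun c => realPMF (s c) (hs0 c) (hs1 c)
  let W : Ω → PMF (F → Fin (n + 1)) := fun ω => w (A ω, K ω)
  have hpq : ∀ a k, prob P (fun ω => (A ω, K ω)) (a, k) = prob P A a * q a k := fun a k =>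
    (prob_mul_condProb P A K a k).symm
  have hYAK : ∀ y a k, prob (joint P W) (fun ω => (ω.2, (A ω.1, K ω.1))) (y, (a, k)) =
      prob P A a * q a k * s (a, k) y := by
    intro y a k
    rw [← hpq]
    have := joint_prob_pair_comp P (fun ω => (A ω, K ω)) w y (a, k)
    rwa [toReal_realPMF] at this
  have hpsF : ∀ (i : F) k y, prob P A i * q i k * s (i, k) y =
      prob P A i * if y i = k then ν y else 0 := fun i k y => by rw [mul_assoc, hsF]
  have hYA : ∀ y a, prob (joint P W) (fun ω => (ω.2, A ω.1)) (y, a) = ν y * prob P A a := by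
    intro y a
    have h1 := hasSum_prob_snd (joint P W) (fun ω => (ω.2, A ω.1)) (fun ω => K ω.1) (y, a)
    have h2 : ∀ k, prob (joint P W) (fun ω => ((ω.2, A ω.1), K ω.1)) ((y, a), k) =
        prob P A a * q a k * s (a, k) y := by
      intro k
      rw [← hYAK]
      exact prob_comp_injective (joint P W) (fun ω => (ω.2, (A ω.1, K ω.1)))
        (f := (Equiv.prodAssoc _ _ _).symm) (Equiv.injective _) (y, (a, k))
    simp only [h2] at h1
    rw [← (hasSum_fintype _).unique h1]
    by_cases ha : a ∈ F
    · simp only [hpsF ⟨a, ha⟩, ← Finset.mul_sum, Finset.sum_ite_eq, Finset.mem_univ, if_true]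
      ring
    · simp only [hsn a ha]
      rw [← Finset.sum_mul, ← Finset.mul_sum, hq1]
      ring
  have hY : ∀ y, prob (joint P W) (fun ω => ω.2) y = ν y := by
    intro y
    have h1 := hasSum_prob_snd (joint P W) (fun ω => ω.2) (fun ω => A ω.1) y
    simp only [hYA] at h1
    have h2 := (hasSum_prob P A).mul_left (ν y)
    rw [mul_one] at h2
    exact h1.unique h2
  let ρ : Fin (n + 1) → ℝ := fun k => prob P K k - ∑ i : F, prob P A i * q i k
  have hρ0 : ∀ k, 0 ≤ ρ k := by
    intro k
    have h1 := sum_le_hasSum F (fun a _ => prob_nonneg _ _ _) (hasSum_prob_fst P A K k)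
    simp only [hpq] at h1
    rw [← Finset.sum_coe_sort] at h1
    exact sub_nonneg.2 h1
  have hYK : ∀ y k, prob (joint P W) (fun ω => (ω.2, K ω.1)) (y, k) =
      ∑ i : F, prob P A i * (if y i = k then ν y else 0) + ρ k * ν y := by
    intro y k
    have h1 := hasSum_prob_fst (joint P W) (fun ω => A ω.1) (fun ω => (ω.2, K ω.1)) (y, k)
    have h2 : ∀ a, prob (joint P W) (fun ω => (A ω.1, (ω.2, K ω.1))) (a, (y, k)) =
        prob P A a * q a k * s (a, k) y := by
      intro a
      rw [← hYAK]
      exact prob_comp_injective (joint P W) (fun ω => (ω.2, (A ω.1, K ω.1)))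
        (f := fun d => (d.2.1, (d.1, d.2.2)))
        (fun c d h => by simp only [Prod.mk.injEq] at h; ext1; exacts [h.2.1, Prod.ext h.1 h.2.2])
        (y, (a, k))
    simp only [h2] at h1
    have h3 := (hasSum_prob_fst P A K k).mul_right (ν y)
    simp only [hpq] at h3
    -- Outside `F` the kernel is `ν`, so the difference to independence has finite support.
    have h4 : HasSum (fun a => prob P A a * q a k * s (a, k) y - prob P A a * q a k * ν y)
        (∑ a ∈ F, (prob P A a * q a k * s (a, k) y - prob P A a * q a k * ν y)) :=
      hasSum_sum_of_ne_finset_zero (fun a ha => by rw [hsn a ha]; ring)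
    have h5 := h4.add h3
    simp only [sub_add_cancel] at h5
    replace h5 := h1.unique h5
    rw [h5, ← Finset.sum_coe_sort, Finset.sum_sub_distrib]
    simp only [hpsF, ρ]
    rw [← Finset.sum_mul]
    ring
  have hI : mutualInfo P A K ≠ ∞ := by
    refine ne_top_of_le_ne_top ?_ (mutualInfo_le_entropy P A K)
    rw [← condEntropy_unit]
    exact condEntropy_ne_top _ _ _
  refine ⟨_, fun ω => (W ω).map (Fintype.equivFin (F → Fin (n + 1))), ?_, ?_, ?_⟩
  · rw [repInfo_map_equiv]
    refine mutualInfo_eq_zero _ _ _ (PMF.ext ?_)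
    rintro ⟨y, a⟩
    rw [prodPMF_apply, ← ENNReal.toReal_eq_toReal_iff' (PMF.apply_ne_top _ _)
      (ENNReal.mul_ne_top (PMF.apply_ne_top _ _) (PMF.apply_ne_top _ _)), ENNReal.toReal_mul]
    have h1 := hYA y a
    rw [← hY, ← joint_prob P W A] at h1
    exact h1
  · rw [repInfo_map_equiv]
    refine le_trans (le_of_eq ?_) (sum_klTerm_le (joint P W) (fun ω => ω.2)
      (fun ω => (A ω.1, K ω.1)) (Finset.univ ×ˢ (F ×ˢ Finset.univ)))
    congr 1
    rw [Finset.sum_product_right, Finset.sum_product]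
    refine Finset.sum_congr rfl fun a ha => Finset.sum_congr rfl fun k _ => ?_
    have h1 := joint_prob P W (fun ω => (A ω, K ω))
    simp only [hYAK, hY, h1, hpq]
    simp only [mul_comm (ν _), klTerm_smul]
    rw [← Finset.mul_sum, entTerm_eq_condProb, ← mul_assoc]
    change prob P A a * q a k * Real.log (1 / q a k) = _
    by_cases hqk : q a k = 0
    · simp [hqk]
    congr 1
    -- Conditioning on an event of probability `q a k` multiplies `ν` by 1 / q a k there, so the
    -- likelihood ratio is constant on the support.
    have h2 : ∀ y, klTerm (s (a, k) y) (ν y) =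
        s (a, k) y * Real.log (1 / q a k) + ν y - s (a, k) y := by
      intro y
      unfold klTerm
      have h3 : s (a, k) y = if y ⟨a, ha⟩ = k then ν y / q a k else 0 := by
        simp only [s, simWeight]
        rw [dif_pos ⟨ha, hqk⟩]
      by_cases h4 : y ⟨a, ha⟩ = k
      · by_cases h5 : ν y = 0
        · simp [h3, h5]
        · rw [h3, if_pos h4, show ν y / q a k / ν y = 1 / q a k by field_simp]
      · simp [h3, h4]
    simp only [h2, Finset.sum_sub_distrib, Finset.sum_add_distrib, ← Finset.sum_mul, hs1, hν1]
    ring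
  · rw [repInfo_map_equiv]
    set LL := Real.log ((mutualInfo P A K).toReal + 5.51) + 1.06 * Real.log 2 with hLL
    set PF := ∑ i : F, prob P A i with hPF
    have hPF1 : PF ≤ 1 := by
      rw [hPF, Finset.sum_coe_sort F (prob P A)]
      exact sum_le_hasSum F (fun a _ => prob_nonneg _ _ _) (hasSum_prob P A)
    have hPF2 : 399 / 400 ≤ PF := by
      rw [hPF, Finset.sum_coe_sort F (prob P A)]; exact hF
    have hρs : ∑ k, ρ k = 1 - PF := by
      simp only [ρ, Finset.sum_sub_distrib]
      rw [sum_prob, Finset.sum_comm]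
      simp only [← Finset.mul_sum, hq1, mul_one]
      rfl
    -- The constant bounds log g' from below when `A` falls outside `F`, where `g` says nothing
    -- about `K`; the price on `F` is log(99/100).
    let g' : (F → Fin (n + 1)) → Fin (n + 1) → ℝ := fun y k => 99 / 100 * g y k + 1 / 100
    have hg'0 : ∀ y k, 0 < g' y k := fun y k => by have := hg0 y k; positivity
    set LB := ∑ i : F, prob P A i * (Real.log (99 / 100) + ∑ y, ν y * Real.log (g y (y i)))
      + (1 - PF) * Real.log (1 / 100) with hLB
    have hgibbs : ENNReal.ofReal LB ≤ repInfo P W K * ENNReal.ofReal (Real.log 2) := by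
      refine le_trans (ENNReal.ofReal_le_ofReal ?_) (sum_klTerm_le (joint P W) (fun ω => ω.2)
        (fun ω => K ω.1) Finset.univ)
      have h1 : ∀ c ∈ Finset.univ, prob (joint P W) (fun ω => (ω.2, K ω.1)) c *
            Real.log (g' c.1 c.2) - ν c.1 * prob P K c.2 * g' c.1 c.2 + ν c.1 * prob P K c.2 ≤
          klTerm (prob (joint P W) (fun ω => (ω.2, K ω.1)) c)
            (prob (joint P W) (fun ω => ω.2) c.1 * prob (joint P W) (fun ω => K ω.1) c.2) := by
        rintro ⟨y, k⟩ -
        have h2 := prob_pair_eq_zero (joint P W) (fun ω => ω.2) (fun ω => K ω.1) (y, k)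
        rw [joint_prob P W K, hY] at h2 ⊢
        exact le_klTerm (prob_nonneg _ _ _) (mul_nonneg (hν0 y) (prob_nonneg _ _ _)) h2 (hg'0 y k)
      refine le_trans ?_ (Finset.sum_le_sum h1)
      rw [Finset.sum_add_distrib, Finset.sum_sub_distrib, Fintype.sum_prod_type,
        Fintype.sum_prod_type, Fintype.sum_prod_type]
      simp only [hYK]
      have h3 : ∑ y, ∑ k, ν y * prob P K k = 1 := by
        simp only [← Finset.mul_sum, sum_prob, mul_one, hν1]
      have h4 : ∑ y, ∑ k, ν y * prob P K k * g' y k ≤ 1 := by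
        rw [Finset.sum_comm]
        calc _ = ∑ k, prob P K k * (99 / 100 * ∑ y, ν y * g y k + 1 / 100) := by
              refine Finset.sum_congr rfl fun k _ => ?_
              have : (1 : ℝ) / 100 = ∑ y, ν y * (1 / 100) := by rw [← Finset.sum_mul, hν1, one_mul]
              rw [this, Finset.mul_sum, ← Finset.sum_add_distrib, Finset.mul_sum]
              refine Finset.sum_congr rfl fun y _ => ?_
              simp only [g']
              ring
          _ ≤ ∑ k, prob P K k * 1 := by
              refine Finset.sum_le_sum fun k _ => mul_le_mul_of_nonneg_left ?_ (prob_nonneg _ _ _)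
              linarith [hg1 k]
          _ = 1 := by simp only [mul_one, sum_prob]
      have h5 : LB ≤ ∑ y, ∑ k, (∑ i : F, prob P A i * (if y i = k then ν y else 0) + ρ k * ν y) *
          Real.log (g' y k) := by
        have h6 : ∑ y, ∑ k, (∑ i : F, prob P A i * (if y i = k then ν y else 0) + ρ k * ν y) *
            Real.log (g' y k) = ∑ i : F, prob P A i * ∑ y, ν y * Real.log (g' y (y i)) +
            ∑ y, ∑ k, ρ k * ν y * Real.log (g' y k) := by
          simp only [add_mul, Finset.sum_add_distrib]
          congr 1
          simp only [Finset.mul_sum]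
          rw [Finset.sum_comm (s := (Finset.univ : Finset F))]
          refine Finset.sum_congr rfl fun y _ => ?_
          simp only [Finset.sum_mul]
          rw [Finset.sum_comm]
          refine Finset.sum_congr rfl fun i _ => ?_
          simp only [mul_ite, ite_mul, mul_zero, zero_mul, Finset.sum_ite_eq, Finset.mem_univ,
            if_true, mul_assoc]
        rw [h6, hLB]
        refine add_le_add (Finset.sum_le_sum fun i _ =>
          mul_le_mul_of_nonneg_left ?_ (prob_nonneg _ _ _)) ?_
        · calc _ = ∑ y, ν y * (Real.log (99 / 100) + Real.log (g y (y i))) := by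
                simp only [mul_add, Finset.sum_add_distrib, ← Finset.sum_mul, hν1, one_mul]
            _ ≤ _ := by
                refine Finset.sum_le_sum fun y _ => mul_le_mul_of_nonneg_left ?_ (hν0 y)
                rw [← Real.log_mul (by norm_num) (hg0 _ _).ne']
                have := hg0 y (y i)
                refine Real.log_le_log (by positivity) ?_
                simp only [g']
                linarith
        · calc _ = ∑ y, ∑ k, ρ k * ν y * Real.log (1 / 100) := by
                simp only [← Finset.sum_mul, hρs]
                rw [← Finset.mul_sum, hν1, mul_one]
            _ ≤ _ := by
                refine Finset.sum_le_sum fun y _ => Finset.sum_le_sum fun k _ =>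
                  mul_le_mul_of_nonneg_left ?_ (mul_nonneg (hρ0 k) (hν0 y))
                refine Real.log_le_log (by norm_num) ?_
                have := hg0 y k
                simp only [g']
                linarith
      linarith
    have hdiv : ∑ i : F, prob P A i * ∑ k, klTerm (q i k) (prob P K k) ≤ J := by
      have h1 := sum_klTerm_le P A K (F ×ˢ Finset.univ)
      rw [ENNReal.ofReal_le_iff_le_toReal (ENNReal.mul_ne_top hI ENNReal.ofReal_ne_top)] at h1
      refine le_trans (le_of_eq ?_) h1
      rw [Finset.sum_product, Finset.sum_coe_sort F (fun a => prob P A a *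
        ∑ k, klTerm (q a k) (prob P K k))]
      simp only [hpq, klTerm_smul, Finset.mul_sum]
    have hH : ∑ a ∈ F, ∑ k, entTerm P K A (k, a) =
        ∑ i : F, prob P A i * ∑ k, q i k * Real.log (1 / q i k) := by
      rw [Finset.sum_coe_sort F (fun a => prob P A a * ∑ k, q a k * Real.log (1 / q a k))]
      simp only [entTerm_eq_condProb, Finset.mul_sum]
      rfl
    have hconst := log_const_bound hJ0 (ρ := 1 - PF) (by linarith)
    have hJI : J / Real.log 2 = (mutualInfo P A K).toReal := by
      rw [hJdef, ENNReal.toReal_mul, ENNReal.toReal_ofReal hl2.le, mul_div_cancel_right₀ _ hl2.ne']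
    rw [hJI, ← hLL, ← htdef] at hconst
    have hmain : ∑ a ∈ F, ∑ k, entTerm P K A (k, a) ≤ LB + LL := by
      have h1 : ∀ i ∈ (Finset.univ : Finset F), prob P A i * (Real.log (99 / 100) + (Real.log t -
          Real.log (1 + 1 / 44) - t * Real.log 45)
          + ∑ k, q i k * Real.log (1 / q i k) - t * ∑ k, klTerm (q i k) (prob P K k)) ≤
          prob P A i * (Real.log (99 / 100) + ∑ y, ν y * Real.log (g y (y i))) := by
        intro i _
        refine mul_le_mul_of_nonneg_left ?_ (prob_nonneg _ _ _)
        have h2 := sum_mul_log_ge ht hc (p := prob P K) (p' := p') (q := q i)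
          (fun k => prob_nonneg _ _ _) (sum_prob P K) (hq0 i) (hq1 i) (fun k hk => by
            have := prob_pos_of_condProb_ne_zero P A K hk
            exact ⟨this, by simp only [p', this.ne', if_false]⟩)
        have h3 := h2.trans (hexp i)
        rw [show (1 + 1 / 44 : ℝ) / (1 / 44) = 45 by norm_num] at h3
        linarith
      have h2 := Finset.sum_le_sum h1
      have h3 : ∑ i : F, prob P A i * (Real.log (99 / 100) + (Real.log t -
          Real.log (1 + 1 / 44) - t * Real.log 45)
          + ∑ k, q i k * Real.log (1 / q i k) - t * ∑ k, klTerm (q i k) (prob P K k)) =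
          PF * (Real.log (99 / 100) + (Real.log t - Real.log (1 + 1 / 44) - t * Real.log 45)) +
          ∑ i : F, prob P A i * ∑ k, q i k * Real.log (1 / q i k) -
          t * ∑ i : F, prob P A i * ∑ k, klTerm (q i k) (prob P K k) := by
        simp only [mul_add, mul_sub, Finset.sum_add_distrib, Finset.sum_sub_distrib,
          ← Finset.sum_mul, mul_left_comm _ t, ← Finset.mul_sum]
        ring
      rw [h3, ← hH] at h2
      have h4 : t * ∑ i : F, prob P A i * ∑ k, klTerm (q i k) (prob P K k) ≤ t * J :=
        mul_le_mul_of_nonneg_left hdiv ht.le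
      have h5 : t * J + t * Real.log 45 = 1 := by
        rw [← mul_add, htdef, inv_mul_cancel₀ (by positivity)]
      -- The bracket is nonpositive, so weighting it by `PF ≤ 1` only helps.
      have h6 : Real.log (99 / 100) + (Real.log t - Real.log (1 + 1 / 44) - t * Real.log 45) ≤
          PF * (Real.log (99 / 100) + (Real.log t - Real.log (1 + 1 / 44) - t * Real.log 45)) := by
        have h7 : Real.log (99 / 100) + (Real.log t - Real.log (1 + 1 / 44) - t * Real.log 45)
            ≤ 0 := by
          have e1 := Real.log_nonpos (show (0 : ℝ) ≤ 99 / 100 by norm_num) (by norm_num)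
          have e2 := Real.log_nonpos ht.le ht1
          have e3 := Real.log_nonneg (show (1 : ℝ) ≤ 1 + 1 / 44 by norm_num)
          have e4 : 0 ≤ t * Real.log 45 := by positivity
          linarith
        nlinarith
      rw [hLB]
      linarith
    calc _ ≤ ENNReal.ofReal (LB + LL) := ENNReal.ofReal_le_ofReal hmain
      _ ≤ ENNReal.ofReal LB + ENNReal.ofReal LL := ENNReal.ofReal_add_le
      _ ≤ _ := by gcongr

end Simulation

/-! ### Functional representation for countable alphabets, and the lower bounds by interpolation. -/

section LowerBounds

variable {Ω : Type u} {α : Type v} {β : Type w} {γ : Type z}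

lemma prob_comp_of_fiber (p : PMF Ω) (A : Ω → α) (f : α → β) (a : α)
    (h : ∀ a', f a' = f a → a' = a) : prob p (fun ω => f (A ω)) (f a) = prob p A a := by
  rw [prob, prob, map_apply_comp, tsum_eq_single a]
  · simp [-PMF.map_apply]
  · intro a' h'
    rw [if_neg fun h'' => h' (h a' h''.symm)]

/-- Merging all symbols outside of a finite set. -/
lemma exists_truncation (G : Finset β) :
    ∃ (n : ℕ) (τ : β → Fin (n + 1)), ∀ t ∈ G, ∀ t', τ t' = τ t → t' = t := by
  classical
  refine ⟨G.card, fun t => if h : t ∈ G then (G.equivFin ⟨t, h⟩).castSucc else Fin.last _, ?_⟩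
  intro t ht t' h
  simp only [ht, dif_pos] at h
  by_cases ht' : t' ∈ G
  · rw [dif_pos ht'] at h
    simpa using h
  · rw [dif_neg ht'] at h
    exact absurd h.symm (Fin.castSucc_lt_last _).ne

/-- The missing mass 1/400 is what the slack in `log_const_bound` pays for. -/
lemma exists_finset_prob_ge [Countable α] (P : PMF Ω) (A : Ω → α) (F₀ : Finset α) :
    ∃ F, F₀ ⊆ F ∧ 399 / 400 ≤ ∑ a ∈ F, prob P A a := by
  have h := (hasSum_prob P A).eventually (lt_mem_nhds (show (399 / 400 : ℝ) < 1 by norm_num))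
  rw [SummationFilter.unconditional_filter] at h
  obtain ⟨F, hF, hF'⟩ := (h.and (Filter.eventually_ge_atTop F₀)).exists
  exact ⟨F, hF', hF.le⟩

/-- The bits lost by the functional representation of `T` given `A`. -/
def frlLoss (P : PMF Ω) (A : Ω → α) (T : Ω → β) : ℝ :=
  Real.logb 2 ((mutualInfo P A T).toReal + 5.51) + 1.06

/-- Functional representation: a representation `Y` independent of `A` from which, together with
`A`, most of the information in `T` can be recovered. -/
theorem exists_functional_rep [Countable α] [Countable β] (P : PMF Ω) (A : Ω → α) (T : Ω → β)
    {x : ℝ≥0∞} (hx : x < condEntropy P T A) :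
    ∃ (N : ℕ) (W : Ω → PMF (Fin N)), repInfo P W A = 0 ∧
      x ≤ repInfo P W T + condEntropy P A T ∧
      (mutualInfo P A T ≠ ∞ → x ≤ repInfo P W T + ENNReal.ofReal (frlLoss P A T)) := by
  classical
  have hl2 : 0 < Real.log 2 := Real.log_pos one_lt_two
  have h1 : x * ENNReal.ofReal (Real.log 2) < condEntropy P T A * ENNReal.ofReal (Real.log 2) :=
    (ENNReal.mul_lt_mul_iff_left ofReal_log_two_ne_zero ENNReal.ofReal_ne_top).2 hx
  rw [condEntropy_mul, ENNReal.tsum_eq_iSup_sum, lt_iSup_iff] at h1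
  obtain ⟨s, hs⟩ := h1
  -- The finitely many entropy terms that already exceed `x` survive the merging unchanged. Merging
  -- only lowers I(Y;·) and I(A;·), so the bounds pass from `K` back to `T`.
  obtain ⟨n, τ, hτ⟩ := exists_truncation (s.image Prod.fst)
  obtain ⟨F, hF₀, hF⟩ := exists_finset_prob_ge P A (s.image Prod.snd)
  let K : Ω → Fin (n + 1) := fun ω => τ (T ω)
  have hterm : ∀ c ∈ s, entTerm P K A (τ c.1, c.2) = entTerm P T A c := by
    intro c hc
    have h2 := prob_comp_of_fiber P (fun ω => (T ω, A ω)) (Prod.map τ id) c (by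
      rintro ⟨t', a'⟩ h
      simp only [Prod.map, id, Prod.mk.injEq] at h
      exact Prod.ext (hτ c.1 (Finset.mem_image_of_mem _ hc) _ h.1) h.2)
    have h3 : prob P (fun ω => (K ω, A ω)) (τ c.1, c.2) = prob P (fun ω => (T ω, A ω)) c := h2
    unfold entTerm
    rw [h3]
  have hsum : ∑ c ∈ s, entTerm P T A c ≤ ∑ a ∈ F, ∑ k, entTerm P K A (k, a) := by
    rw [← Finset.sum_product (f := fun c => entTerm P K A (c.2, c.1))]
    have hinj : Set.InjOn (fun c : β × α => (c.2, τ c.1)) s := by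
      intro c hc d hd h
      simp only [Prod.mk.injEq] at h
      exact Prod.ext (hτ d.1 (Finset.mem_image_of_mem _ hd) _ h.2) h.1
    calc _ = ∑ d ∈ s.image (fun c : β × α => (c.2, τ c.1)), entTerm P K A (d.2, d.1) := by
          rw [Finset.sum_image hinj]
          exact Finset.sum_congr rfl fun c hc => (hterm c hc).symm
      _ ≤ _ := by
          refine Finset.sum_le_sum_of_subset_of_nonneg ?_ fun _ _ _ => entTerm_nonneg _ _ _ _
          intro d hd
          obtain ⟨c, hc, rfl⟩ := Finset.mem_image.1 hd
          exact Finset.mem_product.2 ⟨hF₀ (Finset.mem_image_of_mem _ hc), Finset.mem_univ _⟩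
  obtain ⟨N, W, hW0, hW1, hW2⟩ := exists_simulation P A K F hF
  have hx' : x * ENNReal.ofReal (Real.log 2) ≤
      ENNReal.ofReal (∑ a ∈ F, ∑ k, entTerm P K A (k, a)) := by
    refine hs.le.trans ?_
    rw [← ENNReal.ofReal_sum_of_nonneg fun _ _ => entTerm_nonneg _ _ _ _]
    exact ENNReal.ofReal_le_ofReal hsum
  refine ⟨N, W, hW0, ?_, fun hI => ?_⟩
  · refine (mul_log_two_le_iff.1 (hx'.trans hW1)).trans ?_
    refine le_trans ?_ (repInfo_pair_le P W A T)
    exact repInfo_comp_le P W (fun ω => (A ω, T ω)) (Prod.map id τ)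
  · rw [← mul_log_two_le_iff, add_mul, ← ENNReal.ofReal_mul' hl2.le]
    refine (hx'.trans hW2).trans ?_
    have hK : mutualInfo P A K ≤ mutualInfo P A T := mutualInfo_comp_right_le P A T τ
    gcongr
    · exact repInfo_comp_le P W T τ
    · rw [frlLoss, add_mul, Real.logb, div_mul_cancel₀ _ hl2.ne']
      gcongr

variable {P : PMF Ω} {A : Ω → α} {B : Ω → β} {T : Ω → γ}

lemma condEntropy_unit_left (P : PMF Ω) (T : Ω → γ) : condEntropy P (fun _ => ()) T = 0 := by
  rw [← mul_log_two_inj, zero_mul, condEntropy_mul]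
  refine ENNReal.tsum_eq_zero.2 fun c => ?_
  have h := prob_comp_injective P T (f := fun t => ((), t)) (fun a b h => by simpa using h) c.2
  unfold entTerm
  have h' : prob P (fun ω => ((), T ω)) c = prob P T c.2 := h
  rw [h']
  by_cases h0 : prob P T c.2 = 0
  · simp [h0]
  · simp [div_self h0]

/-- The functional representation for `A` alone reveals nothing about `A`, but possibly much about
`B`; hence the infinite second budget. -/
lemma condEntropy_le_frontier [Countable α] [Countable γ] :
    condEntropy P T A ≤ frontier P A B T 0 ∞ + condEntropy P A T := by
  refine le_of_forall_lt fun x hx => ?_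
  obtain ⟨x', hx', hx''⟩ := exists_between hx
  obtain ⟨N, W, h0, h1, -⟩ := exists_functional_rep P A T hx''
  refine hx'.trans_le (h1.trans ?_)
  gcongr
  exact le_frontier W h0.le le_top

lemma condEntropy_le_frontier_zero [Countable α] [Countable β] [Countable γ] :
    condEntropy P T (fun ω => (A ω, B ω)) ≤
      frontier P A B T 0 0 + condEntropy P (fun ω => (A ω, B ω)) T := by
  refine le_of_forall_lt fun x hx => ?_
  obtain ⟨x', hx', hx''⟩ := exists_between hx
  obtain ⟨N, W, h0, h1, -⟩ := exists_functional_rep P (fun ω => (A ω, B ω)) T hx''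
  refine hx'.trans_le (h1.trans ?_)
  gcongr
  exact le_frontier W ((repInfo_comp_le P W (fun ω => (A ω, B ω)) Prod.fst).trans h0.le)
    ((repInfo_comp_le P W (fun ω => (A ω, B ω)) Prod.snd).trans h0.le)

lemma condEntropy_le_frontier_zero_add_loss [Countable α] [Countable β] [Countable γ]
    (hI : mutualInfo P (fun ω => (A ω, B ω)) T ≠ ∞) :
    condEntropy P T (fun ω => (A ω, B ω)) ≤
      frontier P A B T 0 0 + ENNReal.ofReal (frlLoss P (fun ω => (A ω, B ω)) T) := by
  refine le_of_forall_lt fun x hx => ?_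
  obtain ⟨x', hx', hx''⟩ := exists_between hx
  obtain ⟨N, W, h0, -, h1⟩ := exists_functional_rep P (fun ω => (A ω, B ω)) T hx''
  refine hx'.trans_le ((h1 hI).trans ?_)
  gcongr
  exact le_frontier W ((repInfo_comp_le P W (fun ω => (A ω, B ω)) Prod.fst).trans h0.le)
    ((repInfo_comp_le P W (fun ω => (A ω, B ω)) Prod.snd).trans h0.le)

/-- The functional representation given a constant loses nothing, since a constant has no entropy
given `T`. The budget H(A) is never exceeded. -/
lemma entropy_le_frontier [Countable α] [Countable γ] :
    entropy P T ≤ frontier P A B T (entropy P A) ∞ := by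
  refine le_of_forall_lt fun x hx => ?_
  obtain ⟨x', hx', hx''⟩ := exists_between hx
  rw [← condEntropy_unit] at hx''
  obtain ⟨N, W, -, h1, -⟩ := exists_functional_rep P (fun _ => ()) T hx''
  rw [condEntropy_unit_left, add_zero] at h1
  exact hx'.trans_le (h1.trans (le_frontier W (repInfo_le_entropy P W A) le_top))

lemma condEntropy_chain_comm (A : Ω → α) (B : Ω → β) (T : Ω → γ) :
    condEntropy P T A + condEntropy P B (fun ω => (A ω, T ω)) =
      condEntropy P B A + condEntropy P T (fun ω => (A ω, B ω)) := by
  have h1 := condEntropy_chain P T B A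
  have h2 := condEntropy_chain P B T A
  have h3 : condEntropy P (fun ω => (T ω, B ω)) A = condEntropy P (fun ω => (B ω, T ω)) A :=
    condEntropy_comp_equiv P (fun ω => (B ω, T ω)) A (Equiv.prodComm _ _) (Equiv.refl _)
  have h4 : condEntropy P B (fun ω => (T ω, A ω)) = condEntropy P B (fun ω => (A ω, T ω)) :=
    condEntropy_comp_equiv P B (fun ω => (A ω, T ω)) (Equiv.refl _) (Equiv.prodComm _ _)
  have h5 : condEntropy P T (fun ω => (B ω, A ω)) = condEntropy P T (fun ω => (A ω, B ω)) :=
    condEntropy_comp_equiv P T (fun ω => (A ω, B ω)) (Equiv.refl _) (Equiv.prodComm _ _)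
  rw [← h4, ← h1, h3, h2, h5]

lemma entropy_add_condEntropy_comm (A : Ω → α) (T : Ω → γ) :
    entropy P T + condEntropy P A T = entropy P A + condEntropy P T A := by
  have h := condEntropy_chain_comm (P := P) (fun _ => ()) A T
  have h1 : condEntropy P A (fun ω => ((), T ω)) = condEntropy P A T :=
    condEntropy_comp_equiv P A T (Equiv.refl _) (Equiv.punitProd _).symm
  have h2 : condEntropy P T (fun ω => ((), A ω)) = condEntropy P T A :=
    condEntropy_comp_equiv P T A (Equiv.refl _) (Equiv.punitProd _).symm
  rwa [condEntropy_unit, condEntropy_unit, h1, h2] at h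

lemma coe_add_one_sub {θ : ℝ≥0} (hθ : θ ≤ 1) (x : ℝ≥0∞) :
    θ * x + (1 - θ : ℝ≥0) * x = x := by
  rw [← add_mul, ← ENNReal.coe_add, add_tsub_cancel_of_le hθ, ENNReal.coe_one, one_mul]

/-- Two bounds with the same `h`, one with an extra gain `r`, are averaged; losses and gain are
weighted by the coin. -/
lemma timeShare_bound {θ : ℝ≥0} (hθ : θ ≤ 1) {h r x₁ x₀ f c₁ c₀ : ℝ≥0∞}
    (hf : θ * x₁ + (1 - θ : ℝ≥0) * x₀ ≤ f) (h₁ : h + r ≤ x₁ + c₁) (h₀ : h ≤ x₀ + c₀) :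
    h + θ * r ≤ f + (θ * c₁ + (1 - θ : ℝ≥0) * c₀) := by
  calc h + θ * r = θ * (h + r) + (1 - θ : ℝ≥0) * h := by
        rw [mul_add, add_right_comm, coe_add_one_sub hθ]
    _ ≤ θ * (x₁ + c₁) + (1 - θ : ℝ≥0) * (x₀ + c₀) := by gcongr
    _ = (θ * x₁ + (1 - θ : ℝ≥0) * x₀) + (θ * c₁ + (1 - θ : ℝ≥0) * c₀) := by ring
    _ ≤ _ := by gcongr

/-- Showing i bits at cost i + c with probability ρ/(i + c) spends the budget ρ exactly. As i grows,
the information gained tends to ρ while the weight of the base value `G` tends to 1. -/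
lemma add_le_of_vanishing_timeShare {f G c : ℝ≥0∞} {ρ : ℝ≥0} (hG : G ≠ ∞) (hc : c ≠ ∞)
    (h : ∀ x : ℝ≥0, ∃ i : ℝ≥0, x ≤ i ∧ ∀ θ : ℝ≥0, θ ≤ 1 → (θ * (i + c) : ℝ≥0∞) ≤ ρ →
      (θ * i + (1 - θ : ℝ≥0) * G : ℝ≥0∞) ≤ f) : ρ + G ≤ f := by
  lift G to ℝ≥0 using hG
  lift c to ℝ≥0 using hc
  refine ENNReal.le_of_forall_pos_le_add fun ε hε _ => ?_
  -- The summands ensure in turn that the weight is at most 1, that the loss ρ(c + G)/(i + c) is at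
  -- most ε, and that i is positive.
  obtain ⟨i, hi, h⟩ := h (ρ + ρ * (c + G) / ε + 1)
  have hi0 : 0 < i := lt_of_lt_of_le (by positivity) hi
  have hic : 0 < i + c := by positivity
  have hρi : ρ ≤ i := le_trans (le_trans le_self_add le_self_add) hi
  have hei : ρ * (c + G) / ε ≤ i := le_trans (le_trans le_add_self le_self_add) hi
  have hθ : ρ / (i + c) ≤ 1 := by
    rw [div_le_one₀ hic]; exact hρi.trans le_self_add
  have hθ' : ρ / (i + c) * (i + c) = ρ := div_mul_cancel₀ _ hic.ne'
  refine le_trans ?_ (add_le_add_left (h (ρ / (i + c)) hθ (by exact_mod_cast hθ'.le)) _)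
  rw [← ENNReal.coe_mul, ← ENNReal.coe_mul, ← ENNReal.coe_add, ← ENNReal.coe_add,
    ← ENNReal.coe_add, ENNReal.coe_le_coe, ← NNReal.coe_le_coe]
  push_cast [NNReal.coe_sub hθ]
  have h1 : (ρ : ℝ) / (i + c) * (i + c) = ρ := by exact_mod_cast hθ'
  have h2 : (ρ : ℝ) / (i + c) * (c + G) ≤ ε := by
    rw [div_mul_eq_mul_div, div_le_iff₀ (by exact_mod_cast hic)]
    have h3 : (ρ : ℝ) * (c + G) / ε ≤ i := by exact_mod_cast hei
    rw [div_le_iff₀ (by exact_mod_cast hε)] at h3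
    have h4 : (0 : ℝ) ≤ ε * c := by positivity
    linarith
  linarith

/-- If the constraint on `I(Y; B)` is void, then the `ρ` bits about `A` are worth `ρ` bits
about `T`. -/
theorem condEntropy_add_le_frontier_top [Countable α] [Countable β] [Countable γ] {ρ : ℝ≥0}
    (hρ : ρ ≤ entropy P A) :
    condEntropy P T A + ρ ≤ frontier P A B T ρ ∞ + condEntropy P A T := by
  by_cases hA : condEntropy P A T = ∞
  · simp [hA]
  by_cases hG : frontier P A B T 0 ∞ = ∞
  · have : frontier P A B T ρ ∞ = ∞ := top_le_iff.1 (hG.symm.trans_le <| frontier_mono zero_le le_rfl)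
    simp [this]
  have hcomm := entropy_add_condEntropy_comm (P := P) A T
  by_cases hHA : entropy P A = ∞
  · have hHT : entropy P T = ∞ := by
      by_contra h
      rw [hHA, top_add, ENNReal.add_eq_top] at hcomm
      exact hcomm.elim h hA
    have key : ρ + frontier P A B T 0 ∞ ≤ frontier P A B T ρ ∞ := by
      refine add_le_of_vanishing_timeShare hG hA fun x => ?_
      obtain ⟨N, W, -, h1, -⟩ := exists_functional_rep P (fun _ => ()) T
        (x := x) (by rw [condEntropy_unit, hHT]; exact ENNReal.coe_lt_top)
      rw [condEntropy_unit_left, add_zero] at h1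
      have hfin := repInfo_ne_top P W T
      refine ⟨(repInfo P W T).toNNReal, ?_, fun θ hθ hθ' => ?_⟩
      · rwa [← ENNReal.coe_le_coe, ENNReal.coe_toNNReal hfin]
      · rw [ENNReal.coe_toNNReal hfin] at hθ' ⊢
        have h2 : repInfo P W T ≤ frontier P A B T (repInfo P W T + condEntropy P A T) ∞ :=
          le_frontier W (repInfo_le_add_condEntropy P W A T) le_top
        calc _ ≤ θ * frontier P A B T (repInfo P W T + condEntropy P A T) ∞ +
              (1 - θ : ℝ≥0) * frontier P A B T 0 ∞ := by gcongr
          _ ≤ _ := frontier_concave θ hθ _ _ _ _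
          _ ≤ _ := frontier_mono (by rwa [mul_zero, add_zero]) le_top
    calc _ ≤ frontier P A B T 0 ∞ + condEntropy P A T + ρ := by
          gcongr; exact condEntropy_le_frontier
      _ = ρ + frontier P A B T 0 ∞ + condEntropy P A T := by ring
      _ ≤ _ := by gcongr
  · by_cases hA0 : entropy P A = 0
    · have : (ρ : ℝ≥0∞) = 0 := le_antisymm (hA0 ▸ hρ) zero_le
      rw [this, add_zero]
      exact condEntropy_le_frontier
    obtain ⟨HA, hHA'⟩ : ∃ HA : ℝ≥0, entropy P A = HA := ⟨_, (ENNReal.coe_toNNReal hHA).symm⟩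
    have hHA0 : HA ≠ 0 := by rintro rfl; exact hA0 (by simpa using hHA')
    have hθ : ρ / HA ≤ 1 := by
      rw [div_le_one₀ (pos_iff_ne_zero.2 hHA0)]
      rwa [hHA', ENNReal.coe_le_coe] at hρ
    have hθ' : ((ρ / HA : ℝ≥0) : ℝ≥0∞) * entropy P A = ρ := by
      rw [hHA', ← ENNReal.coe_mul, div_mul_cancel₀ _ hHA0]
    have hconc := frontier_concave (P := P) (A := A) (B := B) (T := T) (ρ / HA) hθ
      (entropy P A) ∞ 0 ∞
    rw [hθ', mul_zero, add_zero] at hconc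
    -- At full budget, H(T) + H(A|T) = H(A) + H(T|A): relative to budget zero, the gain is exactly
    -- H(A), which is slope one.
    have h1 : condEntropy P T A + entropy P A ≤
        frontier P A B T (entropy P A) ∞ + condEntropy P A T := by
      rw [add_comm, ← hcomm]
      gcongr
      exact entropy_le_frontier
    have h2 := timeShare_bound hθ (hconc.trans (frontier_mono le_rfl le_top)) h1
      condEntropy_le_frontier
    rwa [hθ', coe_add_one_sub hθ] at h2

/-- The slope-one line rewritten by the two expansions of H(B,T|A). The second budget is exactly
what I(Y;B) ≤ I(Y;A) + H(B|A) grants for free. -/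
lemma condEntropy_add_full_le [Countable α] [Countable β] [Countable γ] {ρ : ℝ≥0}
    (hρ : ρ ≤ entropy P A) :
    condEntropy P T (fun ω => (A ω, B ω)) + (condEntropy P B A + ρ) ≤
      frontier P A B T ρ (condEntropy P B A + ρ) + condEntropy P (fun ω => (A ω, B ω)) T := by
  calc _ = (condEntropy P B A + condEntropy P T (fun ω => (A ω, B ω))) + ρ := by ring
    _ = (condEntropy P T A + ρ) + condEntropy P B (fun ω => (A ω, T ω)) := by
        rw [← condEntropy_chain_comm]; ring
    _ ≤ (frontier P A B T ρ ∞ + condEntropy P A T) + condEntropy P B (fun ω => (A ω, T ω)) :=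
        add_le_add_left (condEntropy_add_le_frontier_top (B := B) hρ) _
    _ ≤ _ := by
        have h := frontier_le_of_condEntropy (P := P) (A := A) (B := B) (T := T) (ρ := ρ) (σ' := ∞)
        rw [condEntropy_chain P A B T, add_assoc, add_comm (condEntropy P B A)]
        gcongr

lemma frontier_timeShare [Countable α] [Countable β] [Countable γ] {ρ σ : ℝ≥0} {σ₁ : ℝ≥0∞}
    {θ : ℝ≥0} (hθ : θ ≤ 1) (h : θ * σ₁ = σ) :
    θ * frontier P A B T ρ σ₁ + (1 - θ : ℝ≥0) * frontier P A B T 0 0 ≤ frontier P A B T ρ σ := by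
  refine (frontier_concave θ hθ _ _ _ _).trans ?_
  rw [mul_zero, add_zero, add_zero, h]
  refine frontier_mono ?_ le_rfl
  exact mul_le_of_le_one_left zero_le (by exact_mod_cast hθ)

lemma exists_weight {σ : ℝ≥0} {x : ℝ≥0∞} (hx : x ≠ ∞) (h : σ ≤ x) :
    ∃ θ : ℝ≥0, θ ≤ 1 ∧ (σ / x : ℝ≥0∞) = θ ∧ θ * x = σ := by
  lift x to ℝ≥0 using hx
  have h : σ ≤ x := by exact_mod_cast h
  by_cases h0 : x = 0
  -- Here 0/0 = 0, so the weight is 0, as in the stated convention.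
  · subst h0
    have : σ = 0 := le_antisymm h zero_le
    exact ⟨0, zero_le_one, by simp [this], by simp [this]⟩
  · refine ⟨σ / x, (div_le_one₀ (pos_iff_ne_zero.2 h0)).2 h, (ENNReal.coe_div h0).symm, ?_⟩
    rw [← ENNReal.coe_mul, div_mul_cancel₀ _ h0]

/-- The lower bound that trades `H(A, B | T)` for the revealed bits. -/
theorem condEntropy_add_le_frontier [Countable α] [Countable β] [Countable γ] {ρ σ : ℝ≥0}
    (hρ : ρ ≤ entropy P A) (hσ : σ ≤ condEntropy P B A + ρ) :
    condEntropy P T (fun ω => (A ω, B ω)) + σ ≤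
      frontier P A B T ρ σ + condEntropy P (fun ω => (A ω, B ω)) T := by
  by_cases hB : condEntropy P B A = ∞
  · by_cases hC : condEntropy P (fun ω => (A ω, B ω)) T = ∞
    · simp [hC]
    by_cases hG : frontier P A B T 0 0 = ∞
    · have : frontier P A B T ρ σ = ∞ := top_le_iff.1 (hG.symm.trans_le <| frontier_mono zero_le zero_le)
      simp [this]
    have hC' := hC
    rw [condEntropy_chain P A B T, ENNReal.add_eq_top, not_or] at hC'
    -- H(B|A) = ∞ with H(B|A,T) finite forces H(T|A) = ∞. Representations independent of `A` then
    -- carry arbitrarily much information about `T`.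
    have hTA : condEntropy P T A = ∞ := by
      have h := condEntropy_chain_comm (P := P) A B T
      rw [hB, top_add, ENNReal.add_eq_top] at h
      exact h.resolve_right hC'.2
    have key : σ + frontier P A B T 0 0 ≤ frontier P A B T ρ σ := by
      refine add_le_of_vanishing_timeShare hG hC fun x => ?_
      obtain ⟨N, W, h0, h1, -⟩ := exists_functional_rep P A T
        (x := x + condEntropy P A T) (by
          rw [hTA]; exact ENNReal.add_lt_top.2 ⟨ENNReal.coe_lt_top, lt_top_iff_ne_top.2 hC'.1⟩)
      replace h1 := (ENNReal.add_le_add_iff_right hC'.1).1 h1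
      have hfin := repInfo_ne_top P W T
      refine ⟨(repInfo P W T).toNNReal, ?_, fun θ hθ hθ' => ?_⟩
      · rwa [← ENNReal.coe_le_coe, ENNReal.coe_toNNReal hfin]
      · rw [ENNReal.coe_toNNReal hfin] at hθ' ⊢
        have h2 : repInfo P W T ≤ frontier P A B T 0
            (repInfo P W T + condEntropy P (fun ω => (A ω, B ω)) T) := by
          refine le_frontier W h0.le ?_
          exact (repInfo_comp_le P W (fun ω => (A ω, B ω)) Prod.snd).trans
            (repInfo_le_add_condEntropy P W (fun ω => (A ω, B ω)) T)
        calc _ ≤ θ * frontier P A B T 0 (repInfo P W T + condEntropy P (fun ω => (A ω, B ω)) T) +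
              (1 - θ : ℝ≥0) * frontier P A B T 0 0 := by gcongr
          _ ≤ _ := frontier_concave θ hθ _ _ _ _
          _ ≤ _ := frontier_mono (by simp) (by rwa [mul_zero, add_zero])
    calc _ ≤ frontier P A B T 0 0 + condEntropy P (fun ω => (A ω, B ω)) T + σ := by
          gcongr; exact condEntropy_le_frontier_zero
      _ = σ + frontier P A B T 0 0 + condEntropy P (fun ω => (A ω, B ω)) T := by ring
      _ ≤ _ := by gcongr
  -- Interpolation between (ρ, H(B|A) + ρ) and (0, 0); both ends lose H(A,B|T), so the loss does not
  -- depend on the weight.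
  · obtain ⟨θ, hθ, -, hθ'⟩ := exists_weight (ENNReal.add_ne_top.2 ⟨hB, ENNReal.coe_ne_top⟩) hσ
    have h := timeShare_bound hθ (frontier_timeShare hθ hθ') (condEntropy_add_full_le (B := B) (T := T) hρ)
      condEntropy_le_frontier_zero
    rwa [hθ', coe_add_one_sub hθ] at h

/-- The lower bound obtained by revealing bits about `(A, B)` only with probability `θ`. -/
theorem condEntropy_add_le_frontier_mix [Countable α] [Countable β] [Countable γ] {ρ σ : ℝ≥0}
    (hρ : ρ ≤ entropy P A) {θ : ℝ≥0} (hθ : θ ≤ 1) (hθ' : θ * (condEntropy P B A + ρ) = σ)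
    (hI : mutualInfo P (fun ω => (A ω, B ω)) T ≠ ∞) :
    condEntropy P T (fun ω => (A ω, B ω)) + σ ≤
      frontier P A B T ρ σ + (θ * condEntropy P (fun ω => (A ω, B ω)) T +
        (1 - θ : ℝ≥0) * ENNReal.ofReal (frlLoss P (fun ω => (A ω, B ω)) T)) := by
  have h := timeShare_bound hθ (frontier_timeShare hθ hθ') (condEntropy_add_full_le (B := B) (T := T) hρ)
    (condEntropy_le_frontier_zero_add_loss hI)
  rwa [hθ'] at h

end LowerBounds

/-! ### Passage to extended real bounds and to the original trade-off. -/

section Assembly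

variable {Ω : Type u} {α : Type v} {β : Type w} {γ : Type z}

/-- If the second constraint follows from the first one, only `I(Y; A) ≤ ρ` matters. -/
lemma condEntropy_add_le_frontier_slack [Countable α] [Countable β] [Countable γ] {P : PMF Ω}
    {A : Ω → α} {B : Ω → β} {T : Ω → γ} {ρ σ : ℝ≥0} (h : condEntropy P B A + ρ ≤ σ)
    (h' : σ < entropy P B) :
    condEntropy P T A + ρ ≤ frontier P A B T ρ σ + condEntropy P A T := by
  have hfin : condEntropy P B A ≠ ∞ :=
    ne_top_of_le_ne_top ENNReal.coe_ne_top (le_self_add.trans h)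
  -- H(B|A) + ρ ≤ σ < H(B) ≤ H(A) + H(B|A), and the finite H(B|A) cancels.
  have hρ : ρ ≤ entropy P A := by
    have h1 : condEntropy P B A + ρ ≤ condEntropy P B A + entropy P A := by
      refine h.trans (h'.le.trans ?_)
      rw [add_comm _ (entropy P A), ← entropy_add_condEntropy_comm]
      exact le_self_add
    exact (ENNReal.add_le_add_iff_left hfin).1 h1
  refine (condEntropy_add_le_frontier_top (B := B) hρ).trans (add_le_add_left ?_ _)
  refine frontier_le_of_condEntropy.trans (frontier_mono le_rfl ?_)
  rwa [add_comm]

lemma log2_eq {x : ℝ≥0∞} (h0 : x ≠ 0) (h : x ≠ ∞) :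
    log2 x = ((Real.logb 2 x.toReal : ℝ) : EReal) := by
  rw [log2, ENNReal.log_pos_real h0 h, ← EReal.coe_div]
  rfl

lemma log2_top : log2 ∞ = ⊤ := by
  rw [log2, ENNReal.log_top]
  exact EReal.top_div_of_pos_ne_top (EReal.coe_pos.2 (Real.log_pos one_lt_two))
    (EReal.coe_ne_top _)

lemma coe_add_coe_sub_le {h f c : ℝ≥0∞} {s : ℝ≥0} (hle : h + s ≤ f + c) :
    (h : EReal) + ((s : ℝ) : EReal) - (c : EReal) ≤ f := by
  refine EReal.sub_le_of_le_add ?_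
  rw [← EReal.coe_nnreal_eq_coe_real, ← EReal.coe_ennreal_add, ← EReal.coe_ennreal_add]
  exact EReal.coe_ennreal_le_coe_ennreal_iff.2 hle

lemma coe_sub_log2_le {h f I : ℝ≥0∞}
    (hle : I ≠ ∞ → h ≤ f + ENNReal.ofReal (Real.logb 2 (I.toReal + 5.51) + 1.06)) :
    (h : EReal) - (log2 (I + ENNReal.ofReal 5.51) + ((1.06 : ℝ) : EReal)) ≤ f := by
  by_cases hI : I = ∞
  · rw [hI, top_add, log2_top, EReal.top_add_coe, EReal.sub_top]
    exact bot_le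
  refine EReal.sub_le_of_le_add ?_
  have h0 : 0 ≤ Real.logb 2 (I.toReal + 5.51) + 1.06 := by
    have : 0 ≤ Real.logb 2 (I.toReal + 5.51) :=
      Real.logb_nonneg one_lt_two (by linarith [ENNReal.toReal_nonneg (a := I)])
    positivity
  rw [log2_eq (by simp; norm_num) (by simp [hI]), ENNReal.toReal_add hI ENNReal.ofReal_ne_top,
    ENNReal.toReal_ofReal (by norm_num), ← EReal.coe_add, ← max_eq_left h0,
    ← EReal.coe_ennreal_ofReal, ← EReal.coe_ennreal_add]
  exact EReal.coe_ennreal_le_coe_ennreal_iff.2 (hle hI)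

/-- Concavity of the logarithm between I + 5.51 and 1, where it vanishes; then θ ≤ 5.51 θ. -/
lemma mul_logb_le {θ I z : ℝ} (hθ0 : 0 ≤ θ) (hθ : θ ≤ 1) (hI : 0 ≤ I)
    (hz : (1 - θ) * I + 5.51 ≤ z) :
    (1 - θ) * (Real.logb 2 (I + 5.51) + 1.06) ≤ 1.06 + Real.logb 2 z := by
  have h1 := strictConcaveOn_log_Ioi.concaveOn.2 (show I + 5.51 ∈ Set.Ioi (0 : ℝ) by
    simp only [Set.mem_Ioi]; positivity) (show (1 : ℝ) ∈ Set.Ioi (0 : ℝ) by simp)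
    (sub_nonneg.2 hθ) hθ0 (by ring)
  simp only [smul_eq_mul, Real.log_one, mul_zero, add_zero, mul_one] at h1
  have h2 : Real.log ((1 - θ) * (I + 5.51) + θ) ≤ Real.log z := by
    have : 0 ≤ (1 - θ) * I := mul_nonneg (sub_nonneg.2 hθ) hI
    refine Real.log_le_log ?_ ?_ <;> nlinarith
  have hl := Real.log_pos one_lt_two
  have h3 : (1 - θ) * Real.logb 2 (I + 5.51) ≤ Real.logb 2 z := by
    rw [Real.logb, Real.logb, ← mul_div_assoc]
    exact div_le_div_of_nonneg_right (h1.trans h2) hl.le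
  nlinarith

lemma coe_mix_le {h f c I m : ℝ≥0∞} {s θ : ℝ≥0} (hθ : θ ≤ 1) (hIm : I ≤ m)
    (hle : I ≠ ∞ → h + s ≤ f + (θ * c +
      (1 - θ : ℝ≥0) * ENNReal.ofReal (Real.logb 2 (I.toReal + 5.51) + 1.06))) :
    (h : EReal) + ((s : ℝ) : EReal) - ((θ * c : ℝ≥0∞) : EReal) - ((1.06 : ℝ) : EReal) -
      log2 ((1 - θ) * I + θ * m + ENNReal.ofReal 5.51) ≤ f := by
  set z : ℝ≥0∞ := (1 - θ) * I + θ * m + ENNReal.ofReal 5.51 with hz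
  have hsub : (1 - θ : ℝ≥0∞) = (1 - θ : ℝ≥0) := by rw [ENNReal.coe_sub, ENNReal.coe_one]
  by_cases hztop : z = ∞
  · rw [hztop, log2_top, EReal.sub_top]
    exact bot_le
  -- For θ = 1 the first summand of `z` vanishes even if `I` is infinite; `I ≤ m` is what makes a
  -- finite `z` force a finite `I`.
  have hI : I ≠ ∞ := by
    have h1 : I ≤ z := by
      calc I = θ * I + (1 - θ : ℝ≥0) * I := (coe_add_one_sub hθ I).symm
        _ ≤ θ * m + (1 - θ : ℝ≥0) * I := by gcongr
        _ ≤ z := by rw [hz, hsub, add_comm (θ * m : ℝ≥0∞)]; exact le_self_add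
    exact ne_top_of_le_ne_top hztop h1
  by_cases hf : f = ∞
  · rw [hf]; exact le_top
  by_cases hc : θ * c = ∞
  · rw [hc, EReal.coe_ennreal_top, EReal.sub_top, EReal.bot_sub, EReal.bot_sub]
    exact bot_le
  replace hle := hle hI
  generalize (θ * c : ℝ≥0∞) = d at hc hle ⊢
  have h0 : 0 ≤ Real.logb 2 (I.toReal + 5.51) + 1.06 := by
    have : 0 ≤ Real.logb 2 (I.toReal + 5.51) :=
      Real.logb_nonneg one_lt_two (by linarith [ENNReal.toReal_nonneg (a := I)])
    positivity
  have hz0 : z ≠ 0 := by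
    refine ne_of_gt (lt_of_lt_of_le ?_ le_add_self)
    simp; norm_num
  have hh : h ≠ ∞ := by
    refine ne_top_of_le_ne_top ?_ (le_self_add.trans hle)
    exact ENNReal.add_ne_top.2 ⟨hf, ENNReal.add_ne_top.2
      ⟨hc, ENNReal.mul_ne_top ENNReal.coe_ne_top ENNReal.ofReal_ne_top⟩⟩
  have hzr : (1 - θ : ℝ) * I.toReal + 5.51 ≤ z.toReal := by
    have h1 : (1 - θ : ℝ≥0) * I + ENNReal.ofReal 5.51 ≤ z := by
      rw [hz, hsub, add_right_comm]
      exact le_self_add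
    have h2 := ENNReal.toReal_mono hztop h1
    rwa [ENNReal.toReal_add (ENNReal.mul_ne_top ENNReal.coe_ne_top hI) ENNReal.ofReal_ne_top,
      ENNReal.toReal_mul, ENNReal.coe_toReal, NNReal.coe_sub hθ, NNReal.coe_one,
      ENNReal.toReal_ofReal (by norm_num)] at h2
  have hmul := mul_logb_le (NNReal.coe_nonneg θ) (by exact_mod_cast hθ)
    (ENNReal.toReal_nonneg (a := I)) hzr
  rw [log2_eq hz0 hztop]
  lift f to ℝ≥0 using hf
  lift h to ℝ≥0 using hh
  lift d to ℝ≥0 using hc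
  set ℓ := Real.logb 2 (I.toReal + 5.51) + 1.06 with hℓ
  have hle' : h + s ≤ f + (d + (1 - θ) * ℓ.toNNReal) := by
    rw [ENNReal.ofReal] at hle
    exact_mod_cast hle
  rw [← NNReal.coe_le_coe] at hle'
  push_cast [NNReal.coe_sub hθ, Real.coe_toNNReal _ h0] at hle'
  simp only [EReal.coe_nnreal_eq_coe_real]
  rw [← EReal.coe_add, ← EReal.coe_sub, ← EReal.coe_sub, ← EReal.coe_sub, EReal.coe_le_coe_iff]
  linarith

variable {𝒮 : Type u} {𝒳 : Type v} {𝒯 : Type w}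

lemma tradeOff_eq_frontier (P : PMF (𝒮 × 𝒳 × 𝒯)) (r ε : ℝ≥0) :
    tradeOff P r ε = frontier P X S T r ε := by
  unfold tradeOff frontier
  congr 1
  ext i
  refine exists_congr fun 𝒴 => exists_congr fun _ => exists_congr fun W => ?_
  rw [repInfo_symm P W X, and_left_comm]
  rfl

end Assembly

end FairRep

end

/-! ### The bounds in the four regimes: (A, B) is (S, X) in the first and fourth places where r
exceeds or meets its budget last, otherwise (X, S). -/

theorem theorem2 {𝒮 𝒳 𝒯 : Type*} [Finite 𝒮] [Countable 𝒳] [Countable 𝒯]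
    (P : PMF (𝒮 × 𝒳 × 𝒯)) (r ε : ℝ≥0) :
    -- the upper bound
    FairRep.tradeOff P r ε ≤
        min (FairRep.condEntropy P FairRep.T FairRep.S + ε)
          (FairRep.condEntropy P FairRep.T FairRep.X + r) ∧
    -- `L₀` needs no assumption on `r` and `ε`
    FairRep.L0 P ≤ FairRep.tradeOff P r ε ∧
    -- first regime
    (r ≤ FairRep.condEntropy P FairRep.X FairRep.S + ε → ε ≤ FairRep.entropy P FairRep.S →
      max (FairRep.L0 P) (FairRep.L1 P r) ≤ FairRep.tradeOff P r ε ∧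
      (FairRep.entropy P FairRep.X ≠ ∞ →
        max (FairRep.L0 P) (max (FairRep.L1 P r) (FairRep.L2 P r ε)) ≤
          FairRep.tradeOff P r ε)) ∧
    -- second regime
    (FairRep.condEntropy P FairRep.X FairRep.S + ε ≤ r → r < FairRep.entropy P FairRep.X →
      max (FairRep.L0 P) (FairRep.L1' P ε) ≤ FairRep.tradeOff P r ε) ∧
    -- third regime
    (r ≤ ε → ε ≤ FairRep.condEntropy P FairRep.S FairRep.X + r →
      r ≤ FairRep.entropy P FairRep.X →
      max (FairRep.L0 P) (max (FairRep.L3 P ε) (FairRep.L4 P r ε)) ≤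
        FairRep.tradeOff P r ε) ∧
    -- fourth regime
    (FairRep.condEntropy P FairRep.S FairRep.X + r ≤ ε → ε < FairRep.entropy P FairRep.S →
      max (FairRep.L0 P) (FairRep.L3' P r) ≤ FairRep.tradeOff P r ε) := by
  have hSX : FairRep.condEntropy P FairRep.S FairRep.X ≠ ∞ := FairRep.condEntropy_ne_top _ _ _
  have hIm : FairRep.mutualInfo P FairRep.XS FairRep.T ≤
      min (FairRep.entropy P FairRep.T) (FairRep.entropy P FairRep.XS) :=
    le_min (FairRep.mutualInfo_le_entropy P FairRep.XS FairRep.T) (by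
      rw [FairRep.mutualInfo_symm]; exact FairRep.mutualInfo_le_entropy P FairRep.T FairRep.XS)
  have e1 : FairRep.condEntropy P FairRep.T (fun ω => (FairRep.S ω, FairRep.X ω)) =
      FairRep.condEntropy P FairRep.T FairRep.XS :=
    FairRep.condEntropy_comp_equiv P FairRep.T FairRep.XS (Equiv.refl _) (Equiv.prodComm _ _)
  have e2 : FairRep.condEntropy P (fun ω => (FairRep.S ω, FairRep.X ω)) FairRep.T =
      FairRep.condEntropy P FairRep.XS FairRep.T :=
    FairRep.condEntropy_comp_equiv P FairRep.XS FairRep.T (Equiv.prodComm _ _) (Equiv.refl _)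
  have e3 : FairRep.mutualInfo P (fun ω => (FairRep.S ω, FairRep.X ω)) FairRep.T =
      FairRep.mutualInfo P FairRep.XS FairRep.T := by
    rw [FairRep.mutualInfo_symm, FairRep.mutualInfo_symm P FairRep.XS]
    exact le_antisymm (FairRep.mutualInfo_comp_right_le P FairRep.T FairRep.XS Prod.swap)
      (FairRep.mutualInfo_comp_right_le P FairRep.T (fun ω => (FairRep.S ω, FairRep.X ω)) Prod.swap)
  have e4 : FairRep.frlLoss P (fun ω => (FairRep.S ω, FairRep.X ω)) FairRep.T =
      FairRep.frlLoss P FairRep.XS FairRep.T := by unfold FairRep.frlLoss; rw [e3]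
  rw [FairRep.tradeOff_eq_frontier]
  have h0 : FairRep.L0 P ≤ FairRep.frontier P FairRep.X FairRep.S FairRep.T r ε :=
    FairRep.coe_sub_log2_le fun hI =>
      (FairRep.condEntropy_le_frontier_zero_add_loss (A := FairRep.X) (B := FairRep.S) hI).trans
        (add_le_add_left (FairRep.frontier_mono zero_le zero_le) _)
  refine ⟨le_min ?_ FairRep.frontier_le_left, h0, fun h1 h2 => ?_, fun h1 h2 => max_le h0 ?_,
    fun _ h1 h2 => max_le h0 (max_le ?_ ?_), fun h1 h2 => max_le h0 ?_⟩
  · rw [FairRep.frontier_comm]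
    exact FairRep.frontier_le_left
  · have hL1 : FairRep.L1 P r ≤ FairRep.frontier P FairRep.X FairRep.S FairRep.T r ε := by
      have h := FairRep.condEntropy_add_le_frontier (T := FairRep.T) h2 h1
      rw [e1, e2, FairRep.frontier_comm] at h
      exact FairRep.coe_add_coe_sub_le h
    refine ⟨max_le h0 hL1, fun hX => max_le h0 (max_le hL1 ?_)⟩
    -- H(X) + H(S|X) = H(S) + H(X|S), and the left side is finite because `S` has a finite alphabet.
    have hXS : FairRep.condEntropy P FairRep.X FairRep.S ≠ ∞ := by
      have h := FairRep.entropy_add_condEntropy_comm (P := P) FairRep.S FairRep.X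
      have h' := ENNReal.add_ne_top.2 ⟨hX, hSX⟩
      rw [h] at h'
      exact (ENNReal.add_ne_top.1 h').2
    obtain ⟨θ, hθ, hw, hθ'⟩ := FairRep.exists_weight
      (ENNReal.add_ne_top.2 ⟨hXS, ENNReal.coe_ne_top⟩) h1
    rw [FairRep.L2, FairRep.logTerm, FairRep.weight, hw]
    refine FairRep.coe_mix_le hθ hIm fun hI => ?_
    have h := FairRep.condEntropy_add_le_frontier_mix (T := FairRep.T) h2 hθ hθ' (by rwa [e3])
    rwa [e1, e2, e4, FairRep.frontier_comm] at h
  · have h := FairRep.condEntropy_add_le_frontier_slack (T := FairRep.T) h1 h2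
    rw [FairRep.frontier_comm] at h
    rw [FairRep.L1', sub_eq_add_neg, add_right_comm, ← sub_eq_add_neg]
    exact FairRep.coe_add_coe_sub_le h
  · exact FairRep.coe_add_coe_sub_le
      (FairRep.condEntropy_add_le_frontier (T := FairRep.T) h2 h1)
  · obtain ⟨θ, hθ, hw, hθ'⟩ := FairRep.exists_weight
      (ENNReal.add_ne_top.2 ⟨hSX, ENNReal.coe_ne_top⟩) h1
    rw [FairRep.L4, FairRep.logTerm, FairRep.weight', hw]
    exact FairRep.coe_mix_le hθ hIm fun hI =>
      FairRep.condEntropy_add_le_frontier_mix (T := FairRep.T) h2 hθ hθ' hI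
  · have h := FairRep.condEntropy_add_le_frontier_slack (T := FairRep.T) h1 h2
    rw [FairRep.L3', sub_eq_add_neg, add_right_comm, ← sub_eq_add_neg]
    exact FairRep.coe_add_coe_sub_le h
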